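/- **Lemma T.** Let $\lambda>0$ and let $M_\lambda=(\mathbb R\times[0,1])/\!\sim$, $(x,y)\sim(x+\lambda,1-y)$, be the flat Moebius band of width $1$ and length $\lambda$ (equivalently, $[0,\lambda]\times[0,1]$ with $(0,y)\sim(\lambda,1-y)$). Let $I:M_\lambda\to\mathbb R^3$ be a smooth embedded paper Moebius band: $I$ is injective, preserves the arc length of curves, and is infinitely differentiable, meaning that in flat coordinates $I$ has a $C^\infty$ extension to an open neighbourhood of each point, boundary points included. Put $\Omega=I(M_\lambda)$ and $\partial\Omega=I(\partial M_\lambda)$. A *bend* on $\Omega$ is a nondegenerate closed line segment that cuts across $\Omega$: its endpoints lie in $\partial\Omega$ and its other points in $\Omega\setminus\partial\Omega$. A *T-pattern* is a pair of bends that lie in perpendicular intersecting lines. 1. $\Omega$ has a T-pattern whose two bends do not meet outside $\partial\Omega$ (so they are disjoint, except that they may share an endpoint). 2. Suppose that $I$ is smooth and isometric up to the boundary in the strong sense, that is, for some $\varepsilon>0$ it extends to an injective, arc-length-preserving, infinitely differentiable map of the wider band $M_\lambda^\varepsilon=(\mathbb R\times(-\varepsilon,1+\varepsilon))/\!\sim$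 into $\mathbb R^3$. Then $\Omega$ has an embedded T-pattern: one whose two bends are disjoint. -/

import Mathlib

open scoped ContDiff

/-- The Euclidean plane, in which strips of paper lie. -/
abbrev PaperPlane : Type := EuclideanSpace ℝ (Fin 2)

/-- Euclidean 3-space. -/
abbrev PaperSpace : Type := EuclideanSpace ℝ (Fin 3)

/-- The infinite horizontal strip `ℝ × s`, with the metric of the Euclidean plane. -/
def paperStrip (s : Set ℝ) : Set PaperPlane := {p | p 1 ∈ s}

/-- Two points of the strip `ℝ × s` are identified when they differ by a power of the glide
reflection `(x, y) ↦ (x + l, 1 - y)`; its `k`-th power is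
`(x, y) ↦ (x + k l, 1/2 + (-1)^k (y - 1/2))`. -/
def moebiusSetoid (l : ℝ) (s : Set ℝ) : Setoid (paperStrip s) where
  r p q := ∃ k : ℤ, q.1 0 = p.1 0 + k * l ∧ q.1 1 - 1 / 2 = (-1 : ℝ) ^ k * (p.1 1 - 1 / 2)
  iseqv := by
    refine ⟨fun p => ⟨0, by simp, by simp⟩, ?_, ?_⟩
    · rintro p q ⟨k, h0, h1⟩
      refine ⟨-k, by rw [h0]; push_cast; ring, ?_⟩
      rw [h1, ← mul_assoc, ← zpow_add₀ (by norm_num)]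
      simp
    · rintro p q r ⟨k, h0, h1⟩ ⟨m, g0, g1⟩
      refine ⟨m + k, by rw [g0, h0]; push_cast; ring, ?_⟩
      rw [g1, h1, ← mul_assoc, ← zpow_add₀ (by norm_num)]

/-- The flat Moebius band obtained from the strip `ℝ × s` by the identification
`(x, y) ∼ (x + l, 1 - y)`. -/
abbrev FlatMoebius (l : ℝ) (s : Set ℝ) : Type := Quotient (moebiusSetoid l s)

/-- The covering map from the strip to the flat Moebius band. -/
def FlatMoebius.mk (l : ℝ) (s : Set ℝ) (p : paperStrip s) : FlatMoebius l s :=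
  Quotient.mk (moebiusSetoid l s) p

/-- The compact flat Moebius band `M_l` of width `1` and length `l`: the rectangle
`[0, l] × [0, 1]` is a fundamental domain in `ℝ × [0, 1]`, and on it the identification is
`(0, y) ∼ (l, 1 - y)`. -/
abbrev MoebiusBand (l : ℝ) : Type := FlatMoebius l (Set.Icc 0 1)

/-- The open band `M_l^ε`, obtained from `ℝ × (-ε, 1 + ε)` in the same way. It contains `M_l`. -/
abbrev WideMoebiusBand (l ε : ℝ) : Type := FlatMoebius l (Set.Ioo (-ε) (1 + ε))

/-- Infinite differentiability of a map on a flat Moebius band, in the flat coordinates given by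
the covering map: near every point, boundary points included, the map has an extension to an open
subset of the plane that is infinitely differentiable. -/
def IsSmoothOnBand {l : ℝ} {s : Set ℝ} (f : FlatMoebius l s → PaperSpace) : Prop :=
  ∀ p ∈ paperStrip s, ∃ U : Set PaperPlane, IsOpen U ∧ p ∈ U ∧
    ∃ g : PaperPlane → PaperSpace, ContDiffOn ℝ ∞ g U ∧
      ∀ (q : PaperPlane) (hq : q ∈ paperStrip s), q ∈ U → g q = f (FlatMoebius.mk l s ⟨q, hq⟩)

/-- The map preserves arc lengths. Every curve in the band lifts to a curve `c` in the strip of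
the same length, and arc length is total variation. -/
def PreservesArcLength {l : ℝ} {s : Set ℝ} (f : FlatMoebius l s → PaperSpace) : Prop :=
  ∀ (a b : ℝ) (c : ℝ → paperStrip s), a ≤ b → ContinuousOn c (Set.Icc a b) →
    eVariationOn (fun t => f (FlatMoebius.mk l s (c t))) (Set.Icc a b) =
      eVariationOn c (Set.Icc a b)

/-- A smooth isometric embedding of a flat Moebius band in 3-space. -/
structure IsSmoothIsometricEmbedding {l : ℝ} {s : Set ℝ}
    (f : FlatMoebius l s → PaperSpace) : Prop where
  smooth : IsSmoothOnBand f
  isometric : PreservesArcLength f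
  injective : Function.Injective f

/-- For some `ε > 0` the map extends to a smooth isometric embedding of the wider band `M_l^ε`. -/
def ExtendsIsometrically {l : ℝ} (I : MoebiusBand l → PaperSpace) : Prop :=
  ∃ ε : ℝ, 0 < ε ∧ ∃ J : WideMoebiusBand l ε → PaperSpace, IsSmoothIsometricEmbedding J ∧
    ∀ (p : PaperPlane) (hp : p ∈ paperStrip (Set.Icc 0 1))
      (hp' : p ∈ paperStrip (Set.Ioo (-ε) (1 + ε))),
      J (FlatMoebius.mk l _ ⟨p, hp'⟩) = I (FlatMoebius.mk l _ ⟨p, hp⟩)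

/-- The boundary circle of `M_l`. -/
def MoebiusBand.boundary (l : ℝ) : Set (MoebiusBand l) :=
  FlatMoebius.mk l _ '' {p | p.1 1 = 0 ∨ p.1 1 = 1}

/-- A bend on `Ω = I(M_l)`: a nondegenerate line segment that cuts across `Ω`, that is, its
endpoints lie in the boundary of `Ω` and all its other points in the interior. -/
def IsBend {l : ℝ} (I : MoebiusBand l → PaperSpace) (B : Set PaperSpace) : Prop :=
  ∃ a b : PaperSpace, a ≠ b ∧ B = segment ℝ a b ∧
    a ∈ I '' MoebiusBand.boundary l ∧ b ∈ I '' MoebiusBand.boundary l ∧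
    openSegment ℝ a b ⊆ I '' (MoebiusBand.boundary l)ᶜ

/-- A T-pattern: a pair of bends that lie in perpendicular intersecting lines. -/
structure IsTPattern {l : ℝ} (I : MoebiusBand l → PaperSpace) (T B : Set PaperSpace) : Prop where
  bend_left : IsBend I T
  bend_right : IsBend I B
  perpendicular : (affineSpan ℝ T).direction ⟂ (affineSpan ℝ B).direction
  lines_meet : ((affineSpan ℝ T : Set PaperSpace) ∩ (affineSpan ℝ B : Set PaperSpace)).Nonempty

/-! Measured from the core, the band lifts to a map `G` on a strip of half-width `w`, invariant
under the glide reflection. `G` is isometric, so by the Gauss equation its second fundamental form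
has rank at most one. From a point where the form is not zero, its kernel direction stays a kernel
direction along the straight line it spans, and `G` is affine on this line. The form cannot die on
the way: a Codazzi argument shows that the reciprocal of its nonzero entry is affine along the line
(`hessian_kernel_on_ray`). Such a line is not horizontal, since two glides would bring a straight
line in space back to its start. Hence it crosses the whole strip. Two such lines do not cross,
which makes their slopes `1/w`-Lipschitz functions of the point on the axis. An antiperiodic
Lipschitz extension of the slopes rules the flat regions too (`exists_ruling`).

The rulings lie on lines `m t + ℝ A t`, with `m` periodic and `A` antiperiodic of period `l`. Two of
these lines are perpendicular and meet at a zero of the complex function `⟪A x, A y⟫ + i det (m x -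
m y, A x, A y)`. It is symmetric, antiperiodic in each variable and positive on the diagonal.
Without a zero it would have a continuous logarithm, and its increments from `(0, 0)` to `(l, l)`
contradict each other (`exists_zero_of_symmetric_antiperiodic`).

If the two bends met at a height below `w`, injectivity would make them the same ruling up to
glides, hence parallel. For `w = 1/2` this leaves only boundary points; for the wider band it leaves
nothing. -/

/-! ### The differential equation along a kernel line. -/

/-- On an interval where `γ` does not vanish, a solution of `γ² B' = B q` that starts at `0` stays
at `0`; if `B = 0` forces `γ'' γ = 2 γ'²`, then `1 / γ` is affine there. -/
theorem reciprocal_affine_of_ne_zero {a b : ℝ} {B B' γ γ₁ γ₂ q : ℝ → ℝ}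
    (hB : ∀ t ∈ Set.Icc a b, HasDerivAt B (B' t) t) (hq : ContinuousOn q (Set.Icc a b))
    (hBq : ∀ t ∈ Set.Icc a b, γ t ^ 2 * B' t = B t * q t)
    (hγ : ∀ t ∈ Set.Icc a b, HasDerivAt γ (γ₁ t) t)
    (hγ₁ : ∀ t ∈ Set.Icc a b, HasDerivAt γ₁ (γ₂ t) t)
    (hγ₂ : ∀ t ∈ Set.Icc a b, B t = 0 → γ t ≠ 0 → γ₂ t * γ t = 2 * γ₁ t ^ 2)
    (hBa : B a = 0) (hne : ∀ t ∈ Set.Icc a b, γ t ≠ 0) :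
    ∀ t ∈ Set.Icc a b, B t = 0 ∧ γ₁ t / γ t ^ 2 = γ₁ a / γ a ^ 2 ∧
      1 / γ t = 1 / γ a - γ₁ a / γ a ^ 2 * (t - a) := by
  have hBc : ContinuousOn B (Set.Icc a b) := fun t ht => (hB t ht).continuousAt.continuousWithinAt
  have hγc : ContinuousOn γ (Set.Icc a b) := fun t ht => (hγ t ht).continuousAt.continuousWithinAt
  -- After division by `γ ^ 2` the equation is linear with a bounded coefficient, so Grönwall
  -- applies.
  have hB0 : ∀ t ∈ Set.Icc a b, B t = 0 := by
    obtain ⟨K, hK⟩ := isCompact_Icc.exists_bound_of_continuousOn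
      (f := fun t => q t / γ t ^ 2) (s := Set.Icc a b)
      (hq.div (hγc.pow 2) fun t ht => pow_ne_zero 2 (hne t ht))
    refine eq_zero_of_abs_deriv_le_mul_abs_self_of_eq_zero_right (K := K) (f' := B') hBc
      (fun t ht => (hB t (Set.Ico_subset_Icc_self ht)).hasDerivWithinAt) hBa ?_
    intro t ht
    have ht' := Set.Ico_subset_Icc_self ht
    have h1 : B' t = q t / γ t ^ 2 * B t := by
      have := hne t ht'
      field_simp
      linarith [hBq t ht']
    rw [h1, norm_mul]
    exact mul_le_mul_of_nonneg_right (hK t ht') (norm_nonneg _)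
  -- `γ₁ / γ ^ 2` is minus the derivative of `1 / γ`; its own derivative has numerator `γ (γ₂ γ - 2
  -- γ₁ ^ 2)`.
  have hκd : ∀ t ∈ Set.Icc a b, HasDerivAt (fun t => γ₁ t / γ t ^ 2) 0 t := by
    intro t ht
    have h0 := hne t ht
    have := (hγ₁ t ht).div ((hγ t ht).pow 2) (pow_ne_zero 2 h0)
    refine this.congr_deriv ?_
    have h2 := hγ₂ t ht (hB0 t ht) h0
    simp only [Pi.pow_apply]
    rw [div_eq_zero_iff]
    left
    push_cast
    linear_combination γ t * h2
  have hκ : ∀ t ∈ Set.Icc a b, γ₁ t / γ t ^ 2 = γ₁ a / γ a ^ 2 :=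
    constant_of_has_deriv_right_zero
      (fun t ht => (hκd t ht).continuousAt.continuousWithinAt)
      (fun t ht => (hκd t (Set.Ico_subset_Icc_self ht)).hasDerivWithinAt)
  have hrd : ∀ t ∈ Set.Icc a b,
      HasDerivAt (fun t => (γ t)⁻¹ + γ₁ a / γ a ^ 2 * (t - a)) 0 t := by
    intro t ht
    have := ((hγ t ht).inv (hne t ht)).add
      (((hasDerivAt_id t).sub_const a).const_mul (γ₁ a / γ a ^ 2))
    refine this.congr_deriv ?_
    rw [← hκ t ht]
    ring
  have hr := constant_of_has_deriv_right_zero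
      (fun t ht => (hrd t ht).continuousAt.continuousWithinAt)
      (fun t ht => (hrd t (Set.Ico_subset_Icc_self ht)).hasDerivWithinAt)
  intro t ht
  refine ⟨hB0 t ht, hκ t ht, ?_⟩
  have := hr t ht
  simp only [sub_self, mul_zero, add_zero] at this
  rw [one_div, one_div]
  linarith

/-- A solution of `γ² B' = B q` that starts at `0` stays at `0`, and `γ` does not vanish, if
`B = 0` forces `γ'' γ = 2 γ'²`. -/
theorem eq_zero_and_ne_zero_of_reciprocal_affine {T : ℝ} {B B' γ γ₁ γ₂ q : ℝ → ℝ}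
    (hB : ∀ t ∈ Set.Icc 0 T, HasDerivAt B (B' t) t) (hq : ContinuousOn q (Set.Icc 0 T))
    (hBq : ∀ t ∈ Set.Icc 0 T, γ t ^ 2 * B' t = B t * q t)
    (hγ : ∀ t ∈ Set.Icc 0 T, HasDerivAt γ (γ₁ t) t)
    (hγ₁ : ∀ t ∈ Set.Icc 0 T, HasDerivAt γ₁ (γ₂ t) t)
    (hγ₂ : ∀ t ∈ Set.Icc 0 T, B t = 0 → γ t ≠ 0 → γ₂ t * γ t = 2 * γ₁ t ^ 2)
    (hB0 : B 0 = 0) (hγ0 : γ 0 ≠ 0) :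
    ∀ t ∈ Set.Icc 0 T, B t = 0 ∧ γ t ≠ 0 := by
  have hBc : ContinuousOn B (Set.Icc 0 T) := fun t ht => (hB t ht).continuousAt.continuousWithinAt
  have hγc : ContinuousOn γ (Set.Icc 0 T) := fun t ht => (hγ t ht).continuousAt.continuousWithinAt
  have hγ₁c : ContinuousOn γ₁ (Set.Icc 0 T) :=
    fun t ht => (hγ₁ t ht).continuousAt.continuousWithinAt
  set κ : ℝ := γ₁ 0 / γ 0 ^ 2 with hκ
  -- Continuous induction needs a closed condition, and `γ ≠ 0` is open. The equation `γ · (affine)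
  -- = 1` is closed and forces `γ ≠ 0`; the third entry carries the slope of `1 / γ` along.
  set S : Set ℝ := {t | (B t, γ t * (1 / γ 0 - κ * t), γ₁ t - κ * γ t ^ 2) = (0, 1, 0)} with hS
  have hclosed : IsClosed (S ∩ Set.Icc 0 T) := by
    have hc : ContinuousOn
        (fun t => (B t, γ t * (1 / γ 0 - κ * t), γ₁ t - κ * γ t ^ 2)) (Set.Icc 0 T) := by
      fun_prop
    have := hc.preimage_isClosed_of_isClosed isClosed_Icc
      (isClosed_singleton (x := ((0 : ℝ), (1 : ℝ), (0 : ℝ))))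
    rw [Set.inter_comm]
    exact this
  have hsub : Set.Icc 0 T ⊆ S := by
    refine hclosed.Icc_subset_of_forall_mem_nhdsWithin ?_ ?_
    · simp only [hS, Set.mem_ofPred_eq, hB0, hκ, Prod.mk.injEq, true_and]
      constructor
      · field_simp
        ring
      · field_simp
        ring
    · rintro x ⟨hxS, hx⟩
      simp only [hS, Set.mem_ofPred_eq, Prod.mk.injEq] at hxS
      obtain ⟨hBx, hγx, hγ₁x⟩ := hxS
      have hγne : γ x ≠ 0 := by
        intro h
        rw [h, zero_mul] at hγx
        exact zero_ne_one hγx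
      have hnear : ∀ᶠ t in nhdsWithin x (Set.Ici x), γ t ≠ 0 ∧ t < T :=
        (((hγ x ⟨hx.1, hx.2.le⟩).continuousAt.eventually_ne hγne).and
          (eventually_lt_nhds hx.2)).filter_mono nhdsWithin_le_nhds
      obtain ⟨b, hb, hbsub⟩ := (mem_nhdsGE_iff_exists_Icc_subset).1 hnear
      have hbT : Set.Icc x b ⊆ Set.Icc 0 T := fun t ht =>
        ⟨hx.1.trans ht.1, (hbsub ht).2.le⟩
      have key := reciprocal_affine_of_ne_zero (fun t ht => hB t (hbT ht)) (hq.mono hbT)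
        (fun t ht => hBq t (hbT ht)) (fun t ht => hγ t (hbT ht)) (fun t ht => hγ₁ t (hbT ht))
        (fun t ht => hγ₂ t (hbT ht)) hBx (fun t ht => (hbsub ht).1)
      refine Filter.mem_of_superset (Icc_mem_nhdsGT (show x < b from hb)) ?_
      intro t ht
      obtain ⟨h1, h2, h3⟩ := key t ht
      have ht0 : γ t ≠ 0 := (hbsub ht).1
      have hxκ : γ₁ x / γ x ^ 2 = κ := by
        field_simp
        linarith
      have hxr : 1 / γ x = 1 / γ 0 - κ * x := by
        rw [div_eq_iff hγne]
        linarith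
      rw [hxκ] at h2 h3
      rw [hxr] at h3
      simp only [hS, Set.mem_ofPred_eq, Prod.mk.injEq]
      refine ⟨h1, ?_, ?_⟩
      · have : 1 / γ 0 - κ * t = 1 / γ t := by rw [h3]; ring
        rw [this, mul_one_div_cancel ht0]
      · rw [div_eq_iff (pow_ne_zero 2 ht0)] at h2
        rw [h2, sub_self]
  intro t ht
  have := hsub ht
  simp only [hS, Set.mem_ofPred_eq, Prod.mk.injEq] at this
  refine ⟨this.1, fun h => ?_⟩
  rw [h, zero_mul] at this
  exact zero_ne_one this.2.1

/-! ### Directional derivatives and degenerate Hessians. -/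

section DirectionalDerivative

variable {E F : Type*} [NormedAddCommGroup E] [NormedSpace ℝ E]
  [NormedAddCommGroup F] [NormedSpace ℝ F]

/-- The directional derivative of `f` along `v`. -/
noncomputable def dirDeriv (v : E) (f : E → F) (p : E) : F := fderiv ℝ f p v

variable {O : Set E} {f : E → F}

theorem ContDiffOn.dirDeriv (hO : IsOpen O) (hf : ContDiffOn ℝ ∞ f O) (v : E) :
    ContDiffOn ℝ ∞ (dirDeriv v f) O :=
  (((contDiffOn_infty_iff_fderiv_of_isOpen hO).1 hf).2).clm_apply contDiffOn_const

theorem ContDiffOn.differentiableAt_of_isOpen (hO : IsOpen O) (hf : ContDiffOn ℝ ∞ f O)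
    {p : E} (hp : p ∈ O) : DifferentiableAt ℝ f p :=
  (hf.contDiffAt (hO.mem_nhds hp)).differentiableAt (by simp)

theorem dirDeriv_add_left (v w : E) (f : E → F) (p : E) :
    dirDeriv (v + w) f p = dirDeriv v f p + dirDeriv w f p := map_add _ _ _

theorem dirDeriv_smul_left (c : ℝ) (v : E) (f : E → F) (p : E) :
    dirDeriv (c • v) f p = c • dirDeriv v f p := map_smul _ _ _

theorem dirDeriv_neg_left (v : E) (f : E → F) (p : E) :
    dirDeriv (-v) f p = -dirDeriv v f p := map_neg _ _

theorem dirDeriv_congr (hO : IsOpen O) {g : E → F} (h : ∀ q ∈ O, f q = g q) {p : E} (hp : p ∈ O)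
    (v : E) : dirDeriv v f p = dirDeriv v g p := by
  unfold dirDeriv
  rw [Filter.EventuallyEq.fderiv_eq (Filter.eventually_of_mem (hO.mem_nhds hp) h)]

theorem dirDeriv_const (v : E) (c : F) (p : E) : dirDeriv v (fun _ => c) p = 0 := by
  simp [dirDeriv]

theorem dirDeriv_comm (hO : IsOpen O) (hf : ContDiffOn ℝ ∞ f O) {p : E} (hp : p ∈ O) (u v : E) :
    dirDeriv u (dirDeriv v f) p = dirDeriv v (dirDeriv u f) p := by
  have hd : DifferentiableAt ℝ (fderiv ℝ f) p :=
    (((contDiffOn_infty_iff_fderiv_of_isOpen hO).1 hf).2).differentiableAt_of_isOpen hO hp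
  have hs : IsSymmSndFDerivAt ℝ f p :=
    (hf.contDiffAt (hO.mem_nhds hp)).isSymmSndFDerivAt (by simp only [minSmoothness_of_isRCLikeNormedField]; exact WithTop.coe_le_coe.2 le_top)
  have key : ∀ u v : E, dirDeriv u (dirDeriv v f) p = fderiv ℝ (fderiv ℝ f) p u v := by
    intro u v
    have : dirDeriv v f = fun q => fderiv ℝ f q v := rfl
    unfold dirDeriv at *
    rw [this, fderiv_clm_apply hd (differentiableAt_const v)]
    simp
  rw [key, key]
  exact hs u v

theorem hasDerivAt_line (hO : IsOpen O) (hf : ContDiffOn ℝ ∞ f O) {p v : E} {t : ℝ}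
    (ht : p + t • v ∈ O) :
    HasDerivAt (fun τ : ℝ => f (p + τ • v)) (dirDeriv v f (p + t • v)) t := by
  have h1 : HasDerivAt (fun τ : ℝ => p + τ • v) v t := by
    simpa using ((hasDerivAt_id t).smul_const v).const_add p
  exact (hf.differentiableAt_of_isOpen hO ht).hasFDerivAt.comp_hasDerivAt t h1

variable {W : Type*} [NormedAddCommGroup W] [InnerProductSpace ℝ W]

theorem dirDeriv_inner (hO : IsOpen O) {f g : E → W} (hf : ContDiffOn ℝ ∞ f O)
    (hg : ContDiffOn ℝ ∞ g O) {p : E} (hp : p ∈ O) (v : E) :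
    dirDeriv v (fun q => inner ℝ (f q) (g q)) p =
      inner ℝ (f p) (dirDeriv v g p) + inner ℝ (dirDeriv v f p) (g p) := by
  unfold dirDeriv
  exact fderiv_inner_apply (𝕜 := ℝ) (hf.differentiableAt_of_isOpen hO hp)
    (hg.differentiableAt_of_isOpen hO hp) v

theorem dirDeriv_inner_const (hO : IsOpen O) {f : E → W} (hf : ContDiffOn ℝ ∞ f O) (c : W)
    {p : E} (hp : p ∈ O) (v : E) :
    dirDeriv v (fun q => inner ℝ c (f q)) p = inner ℝ c (dirDeriv v f p) := by
  rw [dirDeriv_inner hO contDiffOn_const hf hp, dirDeriv_const, inner_zero_left, add_zero]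

theorem dirDeriv_mul (hO : IsOpen O) {f g : E → ℝ} (hf : ContDiffOn ℝ ∞ f O)
    (hg : ContDiffOn ℝ ∞ g O) {p : E} (hp : p ∈ O) (v : E) :
    dirDeriv v (fun q => f q * g q) p = f p * dirDeriv v g p + g p * dirDeriv v f p := by
  unfold dirDeriv
  rw [fderiv_fun_mul (hf.differentiableAt_of_isOpen hO hp) (hg.differentiableAt_of_isOpen hO hp)]
  simp

theorem dirDeriv_add (hO : IsOpen O) {f g : E → F} (hf : ContDiffOn ℝ ∞ f O)
    (hg : ContDiffOn ℝ ∞ g O) {p : E} (hp : p ∈ O) (v : E) :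
    dirDeriv v (fun q => f q + g q) p = dirDeriv v f p + dirDeriv v g p := by
  unfold dirDeriv
  rw [fderiv_fun_add (hf.differentiableAt_of_isOpen hO hp) (hg.differentiableAt_of_isOpen hO hp)]
  rfl

/-- If the Hessian of `φ` is degenerate in the plane of `ξ` and `η`, and `ξ` spans its kernel at a
point `p` where the Hessian is not zero, then the same holds all along the segment that leaves `p`
in the direction `ξ`. -/
theorem hessian_kernel_on_ray (hO : IsOpen O) {φ : E → ℝ} (hφ : ContDiffOn ℝ ∞ φ O) {ξ η : E}
    (hdet : ∀ q ∈ O, dirDeriv ξ (dirDeriv ξ φ) q * dirDeriv η (dirDeriv η φ) q =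
      dirDeriv ξ (dirDeriv η φ) q ^ 2)
    {p : E} {T : ℝ} (hray : ∀ t ∈ Set.Icc 0 T, p + t • ξ ∈ O)
    (hξη : dirDeriv ξ (dirDeriv η φ) p = 0) (hηη : dirDeriv η (dirDeriv η φ) p ≠ 0) :
    ∀ t ∈ Set.Icc 0 T, dirDeriv ξ (dirDeriv η φ) (p + t • ξ) = 0 ∧
      dirDeriv η (dirDeriv η φ) (p + t • ξ) ≠ 0 := by
  set a := dirDeriv ξ (dirDeriv ξ φ) with ha
  set b := dirDeriv ξ (dirDeriv η φ) with hb
  set g := dirDeriv η (dirDeriv η φ) with hg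
  have sξ := hφ.dirDeriv hO ξ
  have sη := hφ.dirDeriv hO η
  have sa : ContDiffOn ℝ ∞ a O := sξ.dirDeriv hO ξ
  have sb : ContDiffOn ℝ ∞ b O := sη.dirDeriv hO ξ
  have sg : ContDiffOn ℝ ∞ g O := sη.dirDeriv hO η
  have hb' : ∀ q ∈ O, b q = dirDeriv η (dirDeriv ξ φ) q := fun q hq => dirDeriv_comm hO hφ hq ξ η
  -- Third and fourth derivatives of `φ` commute (Codazzi). They are combined below with the first
  -- and second `η`-derivatives of `a g = b ^ 2`.
  have cod1 : ∀ q ∈ O, dirDeriv ξ b q = dirDeriv η a q := by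
    intro q hq
    rw [dirDeriv_congr hO hb' hq, dirDeriv_comm hO sξ hq]
  have cod2 : ∀ q ∈ O, dirDeriv η b q = dirDeriv ξ g q := fun q hq =>
    dirDeriv_comm hO sη hq η ξ
  have cod3 : ∀ q ∈ O, dirDeriv η (dirDeriv η a) q = dirDeriv ξ (dirDeriv ξ g) q := by
    intro q hq
    rw [dirDeriv_congr hO (fun r hr => (cod1 r hr).symm) hq, dirDeriv_comm hO sb hq,
      dirDeriv_congr hO cod2 hq]
  have d1 : ∀ q ∈ O, a q * dirDeriv η g q + g q * dirDeriv η a q = 2 * (b q * dirDeriv η b q) := by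
    intro q hq
    have h1 := dirDeriv_mul hO sa sg hq η
    have h2 := dirDeriv_mul hO sb sb hq η
    have h3 := dirDeriv_congr hO (f := fun q => a q * g q) (g := fun q => b q * b q)
      (fun r hr => by rw [hdet r hr]; ring) hq η
    linarith
  have sag := sa.dirDeriv hO η
  have sgg := sg.dirDeriv hO η
  have sbb := sb.dirDeriv hO η
  have d2 : ∀ q ∈ O, a q = 0 → b q = 0 → dirDeriv η a q = 0 →
      g q * dirDeriv η (dirDeriv η a) q = 2 * dirDeriv η b q ^ 2 := by
    intro q hq h0 h1 h2
    have e1 := dirDeriv_mul hO sa sgg hq η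
    have e2 := dirDeriv_mul hO sg sag hq η
    have e3 := dirDeriv_mul hO sb sbb hq η
    have e4 := dirDeriv_congr hO (g := fun q => b q * dirDeriv η b q + b q * dirDeriv η b q)
      (f := fun q => a q * dirDeriv η g q + g q * dirDeriv η a q)
      (fun r hr => by rw [d1 r hr]; ring) hq η
    have e5 := dirDeriv_add hO (sa.mul sgg) (sg.mul sag) hq η
    have e6 := dirDeriv_add hO (sb.mul sbb) (sb.mul sbb) hq η
    rw [e5, e6, e1, e2, e3, h0, h1, h2] at e4
    linarith
  have hline : ContinuousOn (fun t : ℝ => p + t • ξ) (Set.Icc 0 T) := by fun_prop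
  refine eq_zero_and_ne_zero_of_reciprocal_affine
    (B := fun t => b (p + t • ξ)) (B' := fun t => dirDeriv ξ b (p + t • ξ))
    (γ := fun t => g (p + t • ξ)) (γ₁ := fun t => dirDeriv ξ g (p + t • ξ))
    (γ₂ := fun t => dirDeriv ξ (dirDeriv ξ g) (p + t • ξ))
    -- From `g ^ 2 ∂ξ b = g (g ∂η a) = 2 g b ∂ξ g - (a g) ∂η g`, where `a g = b ^ 2` lets one factor
    -- out `b`.
    (q := fun t => 2 * g (p + t • ξ) * dirDeriv ξ g (p + t • ξ) -
      b (p + t • ξ) * dirDeriv η g (p + t • ξ))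
    (fun t ht => hasDerivAt_line hO sb (hray t ht)) ?_ ?_
    (fun t ht => hasDerivAt_line hO sg (hray t ht))
    (fun t ht => hasDerivAt_line hO (sg.dirDeriv hO ξ) (hray t ht)) ?_ (by simpa using hξη)
    (by simpa using hηη)
  · exact (((sg.continuousOn.const_smul (2 : ℝ)).mul (sg.dirDeriv hO ξ).continuousOn).sub
      (sb.continuousOn.mul sgg.continuousOn)).comp hline hray
  · intro t ht
    have hq := hray t ht
    have h1 := d1 _ hq
    have h2 := hdet _ hq
    rw [cod1 _ hq]
    rw [cod2 _ hq] at h1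
    linear_combination g (p + t • ξ) * h1 - dirDeriv η g (p + t • ξ) * h2
  · intro t ht h0 hne
    have hq := hray t ht
    change b (p + t • ξ) = 0 at h0
    change g (p + t • ξ) ≠ 0 at hne
    have ha0 : a (p + t • ξ) = 0 := by
      have := hdet _ hq
      rw [h0] at this
      simpa [hne] using this
    have h1 : dirDeriv η a (p + t • ξ) = 0 := by
      have := d1 _ hq
      rw [h0, ha0] at this
      simpa [hne] using this
    have := d2 _ hq ha0 h0 h1
    rw [cod3 _ hq, cod2 _ hq] at this
    linarith

end DirectionalDerivative

/-! ### Flat surfaces in space: Gauss equation and kernel lines. -/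

section FlatSurface

variable {E W : Type*} [NormedAddCommGroup E] [NormedSpace ℝ E]
  [NormedAddCommGroup W] [InnerProductSpace ℝ W]

/-- A smooth map from an open subset `O` of a normed space to a Euclidean space of dimension `3`
that has rank at least `2` and pulls the inner product back to a constant bilinear form. -/
structure IsFlatMap (O : Set E) (G : E → W) : Prop where
  isOpen : IsOpen O
  smooth : ContDiffOn ℝ ∞ G O
  metric : ∃ β : E → E → ℝ, ∀ p ∈ O, ∀ v w, inner ℝ (dirDeriv v G p) (dirDeriv w G p) = β v w
  rank : ∀ p ∈ O, ∃ v w, LinearIndependent ℝ ![dirDeriv v G p, dirDeriv w G p]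
  dim : Module.finrank ℝ W = 3

/-- The orthogonal complement of a plane in dimension three is a line. -/
theorem exists_normal_of_finrank_eq_three (hW : Module.finrank ℝ W = 3) {a b : W}
    (hab : LinearIndependent ℝ ![a, b]) :
    ∃ n : W, ∀ v : W, inner ℝ v a = 0 → inner ℝ v b = 0 → ∃ c : ℝ, v = c • n := by
  have : FiniteDimensional ℝ W := Module.finite_of_finrank_pos (by omega)
  set K := Submodule.span ℝ (Set.range ![a, b]) with hK
  have h2 : Module.finrank ℝ K = 2 := by
    simpa using finrank_span_eq_card hab
  have h1 : Module.finrank ℝ Kᗮ = 1 := by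
    have := K.finrank_add_finrank_orthogonal
    omega
  obtain ⟨n, -, hn⟩ := finrank_eq_one_iff'.1 h1
  refine ⟨n, fun v hva hvb => ?_⟩
  have hv : v ∈ Kᗮ := by
    rw [hK, Submodule.mem_orthogonal]
    intro u hu
    induction hu using Submodule.span_induction with
    | mem x hx =>
      obtain ⟨i, rfl⟩ := hx
      fin_cases i
      · simpa [real_inner_comm] using hva
      · simpa [real_inner_comm] using hvb
    | zero => simp
    | add x y _ _ hx hy => rw [inner_add_left, hx, hy, add_zero]
    | smul c x _ hx => rw [inner_smul_left, hx, mul_zero]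
  obtain ⟨c, hc⟩ := hn ⟨v, hv⟩
  exact ⟨c, by rw [← Submodule.coe_smul, hc]⟩

namespace IsFlatMap

variable {O : Set E} {G : E → W} (h : IsFlatMap O G)
include h

theorem second_smooth (u v : E) : ContDiffOn ℝ ∞ (dirDeriv u (dirDeriv v G)) O :=
  (h.smooth.dirDeriv h.isOpen v).dirDeriv h.isOpen u

theorem second_comm {p : E} (hp : p ∈ O) (u v : E) :
    dirDeriv u (dirDeriv v G) p = dirDeriv v (dirDeriv u G) p :=
  dirDeriv_comm h.isOpen h.smooth hp u v

theorem second_add_right {p : E} (hp : p ∈ O) (u v w : E) :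
    dirDeriv u (dirDeriv (v + w) G) p =
      dirDeriv u (dirDeriv v G) p + dirDeriv u (dirDeriv w G) p := by
  rw [h.second_comm hp, dirDeriv_add_left, h.second_comm hp v, h.second_comm hp w]

theorem second_smul_right {p : E} (hp : p ∈ O) (c : ℝ) (u v : E) :
    dirDeriv u (dirDeriv (c • v) G) p = c • dirDeriv u (dirDeriv v G) p := by
  rw [h.second_comm hp, dirDeriv_smul_left, h.second_comm hp]

/-- The second derivatives are normal to the surface. -/
theorem second_inner_first {p : E} (hp : p ∈ O) (u v w : E) :
    inner ℝ (dirDeriv u (dirDeriv v G) p) (dirDeriv w G p) = 0 := by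
  obtain ⟨β, hβ⟩ := h.metric
  -- The metric is constant, so the expression is antisymmetric in `v`, `w`; it is symmetric in `u`,
  -- `v`. Together these force it to vanish.
  have key : ∀ u v w : E, inner ℝ (dirDeriv u (dirDeriv v G) p) (dirDeriv w G p) =
      -inner ℝ (dirDeriv u (dirDeriv w G) p) (dirDeriv v G p) := by
    intro u v w
    have h1 := dirDeriv_inner h.isOpen (h.smooth.dirDeriv h.isOpen v)
      (h.smooth.dirDeriv h.isOpen w) hp u
    rw [dirDeriv_congr h.isOpen (fun q hq => hβ q hq v w) hp, dirDeriv_const,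
      real_inner_comm] at h1
    linarith
  have h1 := key u v w
  rw [h.second_comm hp u w, key w u v, h.second_comm hp w v, key v w u,
    h.second_comm hp v u] at h1
  linarith

/-- The Gauss equation. -/
theorem gauss_equation {p : E} (hp : p ∈ O) (ξ η : E) :
    inner ℝ (dirDeriv ξ (dirDeriv ξ G) p) (dirDeriv η (dirDeriv η G) p) =
      inner ℝ (dirDeriv ξ (dirDeriv η G) p) (dirDeriv ξ (dirDeriv η G) p) := by
  -- Differentiating normality moves a derivative across the inner product. Two such moves, with the
  -- third derivatives commuted in between, give the equation.
  have key : ∀ u v w z : E,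
      inner ℝ (dirDeriv u (dirDeriv v G) p) (dirDeriv z (dirDeriv w G) p) =
        -inner ℝ (dirDeriv z (dirDeriv u (dirDeriv v G)) p) (dirDeriv w G p) := by
    intro u v w z
    have h1 := dirDeriv_inner h.isOpen (h.second_smooth u v)
      (h.smooth.dirDeriv h.isOpen w) hp z
    rw [dirDeriv_congr h.isOpen (fun q hq => h.second_inner_first hq u v w) hp,
      dirDeriv_const] at h1
    linarith
  rw [key, dirDeriv_comm h.isOpen (h.smooth.dirDeriv h.isOpen ξ) hp, ← key,
    h.second_comm hp η ξ]

/-- At each point all second derivatives are multiples of one vector. -/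
theorem exists_second_eq_smul {p : E} (hp : p ∈ O) :
    ∃ n : W, ∀ u v : E, ∃ c : ℝ, dirDeriv u (dirDeriv v G) p = c • n := by
  obtain ⟨v, w, hvw⟩ := h.rank p hp
  obtain ⟨n, hn⟩ := exists_normal_of_finrank_eq_three h.dim hvw
  exact ⟨n, fun a b => hn _ (h.second_inner_first hp a b v) (h.second_inner_first hp a b w)⟩

/-- By the Gauss equation the `ξξ` and `ηη` derivatives are orthogonal. They are multiples of one
vector and the second is not zero. -/
theorem second_self_eq_zero {p : E} (hp : p ∈ O) {ξ η : E}
    (h1 : dirDeriv ξ (dirDeriv η G) p = 0) (h2 : dirDeriv η (dirDeriv η G) p ≠ 0) :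
    dirDeriv ξ (dirDeriv ξ G) p = 0 := by
  obtain ⟨n, hn⟩ := h.exists_second_eq_smul hp
  obtain ⟨a, ha⟩ := hn ξ ξ
  obtain ⟨c, hc⟩ := hn η η
  have hg := h.gauss_equation hp ξ η
  rw [h1, inner_zero_left, ha, hc, inner_smul_left, inner_smul_right] at hg
  rw [hc] at h2
  have hc0 : c ≠ 0 := fun h => h2 (by rw [h, zero_smul])
  have hn0 : n ≠ 0 := fun h => h2 (by rw [h, smul_zero])
  have : a = 0 := by simpa [hc0, hn0] using hg
  rw [ha, this, zero_smul]

/-- The kernel direction of the second fundamental form at a point where it is not zero is the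
kernel direction along a segment. -/
theorem kernel_on_segment {p ζ η : E} (hseg : ∀ t ∈ Set.Icc (0 : ℝ) 1, p + t • ζ ∈ O)
    (hζη : dirDeriv ζ (dirDeriv η G) p = 0) (hηη : dirDeriv η (dirDeriv η G) p ≠ 0) :
    ∀ t ∈ Set.Icc (0 : ℝ) 1, dirDeriv ζ (dirDeriv η G) (p + t • ζ) = 0 ∧
      dirDeriv η (dirDeriv η G) (p + t • ζ) ≠ 0 := by
  -- The height function in the fixed direction `c` replaces a normal field. Its Hessian is
  -- degenerate by the Gauss equation, and where its `ηη` entry is not zero, `c` is not orthogonal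
  -- to the normal, so a vanishing scalar entry means a vanishing second derivative of `G`.
  set c := dirDeriv η (dirDeriv η G) p with hc
  have hφ : ContDiffOn ℝ ∞ (fun q => inner ℝ c (G q)) O := contDiffOn_const.inner ℝ h.smooth
  have hp : p ∈ O := by simpa using hseg 0 (by simp)
  have hsecond : ∀ u v : E, ∀ q ∈ O,
      dirDeriv u (dirDeriv v (fun q => inner ℝ c (G q))) q =
        inner ℝ c (dirDeriv u (dirDeriv v G) q) := by
    intro u v q hq
    rw [dirDeriv_congr h.isOpen (fun r hr => dirDeriv_inner_const h.isOpen h.smooth c hr v) hq,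
      dirDeriv_inner_const h.isOpen (h.smooth.dirDeriv h.isOpen v) c hq]
  have key := hessian_kernel_on_ray h.isOpen hφ (ξ := ζ) (η := η) (p := p) (T := 1) ?_ hseg ?_ ?_
  · intro t ht
    have hq := hseg t ht
    have hk := key t ht
    rw [hsecond _ _ _ hq, hsecond _ _ _ hq] at hk
    obtain ⟨n, hn⟩ := h.exists_second_eq_smul hq
    obtain ⟨b, hb⟩ := hn ζ η
    obtain ⟨g, hg⟩ := hn η η
    have hne : inner ℝ c n ≠ 0 := by
      intro h0
      apply hk.2
      rw [hg, inner_smul_right, h0, mul_zero]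
    refine ⟨?_, fun h0 => hk.2 (by rw [h0, inner_zero_right])⟩
    have := hk.1
    rw [hb, inner_smul_right] at this
    have hb0 : b = 0 := by simpa [hne] using this
    rw [hb, hb0, zero_smul]
  · intro q hq
    rw [hsecond _ _ _ hq, hsecond _ _ _ hq, hsecond _ _ _ hq]
    obtain ⟨n, hn⟩ := h.exists_second_eq_smul hq
    obtain ⟨a, ha⟩ := hn ζ ζ
    obtain ⟨b, hb⟩ := hn ζ η
    obtain ⟨g, hg⟩ := hn η η
    have hgauss := h.gauss_equation hq ζ η
    rw [ha, hb, hg] at hgauss ⊢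
    simp only [inner_smul_left, inner_smul_right, conj_trivial] at hgauss ⊢
    rcases eq_or_ne n 0 with rfl | hn0
    · simp
    · have hnn : inner ℝ n n ≠ 0 := by simpa using hn0
      have : a * g = b * b := by
        apply mul_right_cancel₀ hnn
        linarith
      linear_combination (inner ℝ c n) ^ 2 * this
  · rw [hsecond _ _ _ hp, hζη, inner_zero_right]
  · rw [hsecond _ _ _ hp, ← hc]
    simpa using hηη

/-- If the second derivative along a segment vanishes, the map is affine on the segment. -/
theorem eq_add_of_second_eq_zero {p ζ : E} (hseg : ∀ t ∈ Set.Icc (0 : ℝ) 1, p + t • ζ ∈ O)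
    (h0 : ∀ t ∈ Set.Icc (0 : ℝ) 1, dirDeriv ζ (dirDeriv ζ G) (p + t • ζ) = 0) :
    G (p + ζ) = G p + dirDeriv ζ G p := by
  have d1 : ∀ t ∈ Set.Icc (0 : ℝ) 1,
      HasDerivAt (fun t : ℝ => dirDeriv ζ G (p + t • ζ)) 0 t := by
    intro t ht
    have := hasDerivAt_line h.isOpen (h.smooth.dirDeriv h.isOpen ζ) (hseg t ht)
    rwa [h0 t ht] at this
  have c1 := constant_of_has_deriv_right_zero
    (fun t ht => (d1 t ht).continuousAt.continuousWithinAt)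
    (fun t ht => (d1 t (Set.Ico_subset_Icc_self ht)).hasDerivWithinAt)
  have d2 : ∀ t ∈ Set.Icc (0 : ℝ) 1,
      HasDerivAt (fun t : ℝ => G (p + t • ζ) - t • dirDeriv ζ G p) 0 t := by
    intro t ht
    have e1 := hasDerivAt_line h.isOpen h.smooth (hseg t ht)
    refine (e1.sub ((hasDerivAt_id t).smul_const (dirDeriv ζ G p))).congr_deriv ?_
    have := c1 t ht
    simp only [zero_smul, add_zero] at this
    rw [this, one_smul, sub_self]
  have c2 := constant_of_has_deriv_right_zero
    (fun t ht => (d2 t ht).continuousAt.continuousWithinAt)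
    (fun t ht => (d2 t (Set.Ico_subset_Icc_self ht)).hasDerivWithinAt) 1 (by simp)
  simp only [one_smul, zero_smul, add_zero, sub_zero] at c2
  rw [← c2, sub_add_cancel]

end IsFlatMap

end FlatSurface

/-! ### The ruling of a flat Moebius band. -/

/-- The open horizontal strip of half-width `w` about the axis. -/
def openStrip (w : ℝ) : Set (ℝ × ℝ) := {p | |p.2| < w}

theorem isOpen_openStrip (w : ℝ) : IsOpen (openStrip w) :=
  isOpen_lt (by fun_prop) continuous_const

theorem add_smul_mem_openStrip {w : ℝ} {p v : ℝ × ℝ} (hp : p ∈ openStrip w)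
    (hv : p + v ∈ openStrip w) {t : ℝ} (ht : t ∈ Set.Icc (0 : ℝ) 1) :
    p + t • v ∈ openStrip w := by
  have hc : Convex ℝ (openStrip w) := by
    have : openStrip w = LinearMap.snd ℝ ℝ ℝ ⁻¹' Set.Ioo (-w) w := by
      ext q
      simp [openStrip, abs_lt]
    rw [this]
    exact (convex_Ioo _ _).linear_preimage _
  exact hc.add_smul_mem hp hv ht

/-- Two lines `x = t + s y` and `x = t' + s' y` with `|s - s'| ≤ |t - t'| / w` can meet at a height
less than `w` only if `t = t'`. -/
theorem eq_of_lines_meet {w t r s s' y : ℝ} (hw : 0 < w) (hs : |s - s'| ≤ w⁻¹ * |t - r|)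
    (hy : |y| < w) (h : t + s * y = r + s' * y) : t = r := by
  by_contra hne
  have h3 : |t - r| = |s - s'| * |y| := by
    rw [← abs_mul, ← abs_neg (t - r)]
    congr 1
    linear_combination -h
  have h5 : 0 < |t - r| := abs_pos.2 (sub_ne_zero.2 hne)
  rw [inv_mul_eq_div, le_div_iff₀ hw] at hs
  have h6 : 0 < |s - s'| := by
    refine (abs_nonneg _).lt_of_ne fun h7 => ?_
    rw [← h7, zero_mul] at h3
    exact h5.ne' h3
  nlinarith [mul_lt_mul_of_pos_left hy h6]

/-- A Lipschitz function on a subset of the line that changes its sign under a translation has a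
Lipschitz extension to the line that changes its sign under the translation. -/
theorem exists_lipschitz_antiperiodic_extension {S : Set ℝ} {f : ℝ → ℝ} {K l : ℝ} (hK : 0 ≤ K)
    (hf : ∀ t ∈ S, ∀ r ∈ S, |f t - f r| ≤ K * |t - r|)
    (hS : ∀ t, t + l ∈ S ↔ t ∈ S) (hfl : ∀ t ∈ S, f (t + l) = -f t) :
    ∃ s : ℝ → ℝ, (∀ t ∈ S, s t = f t) ∧ (∀ t r, |s t - s r| ≤ K * |t - r|) ∧
      ∀ t, s (t + l) = -s t := by
  rcases S.eq_empty_or_nonempty with rfl | ⟨r₀, hr₀⟩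
  · exact ⟨0, by simp, fun t r => by simpa using by positivity, by simp⟩
  have : Nonempty S := ⟨⟨r₀, hr₀⟩⟩
  -- The McShane extension. On `S` the function `f` has period `2 l`, so `g` inherits this period.
  set g : ℝ → ℝ := fun t => ⨅ r : S, (f (r : ℝ) + K * |t - (r : ℝ)|) with hg
  have hbound : ∀ t r : ℝ, r ∈ S → f r₀ - K * |t - r₀| ≤ f r + K * |t - r| := by
    intro t r hr
    have h1 := (abs_le.1 (hf r₀ hr₀ r hr)).2
    have h2 : |r₀ - r| ≤ |t - r₀| + |t - r| := by
      rw [abs_sub_comm t r₀]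
      exact abs_sub_le _ _ _
    nlinarith [mul_le_mul_of_nonneg_left h2 hK]
  have hbdd : ∀ t, BddBelow (Set.range fun r : S => f (r : ℝ) + K * |t - (r : ℝ)|) := by
    intro t
    refine ⟨f r₀ - K * |t - r₀|, ?_⟩
    rintro _ ⟨r, rfl⟩
    exact hbound t r r.2
  have hgS : ∀ t ∈ S, g t = f t := by
    intro t ht
    refine le_antisymm ?_ ?_
    · simpa using ciInf_le (hbdd t) ⟨t, ht⟩
    · refine le_ciInf fun r => ?_
      have := (abs_le.1 (hf t ht r r.2)).2
      linarith
  have hglip : ∀ t u, g t ≤ g u + K * |t - u| := by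
    intro t u
    rw [← sub_le_iff_le_add]
    refine le_ciInf fun r => ?_
    have h1 : g t ≤ f r + K * |t - r| := ciInf_le (hbdd t) r
    have h2 := mul_le_mul_of_nonneg_left (abs_sub_le t u r) hK
    linarith
  have hglip' : ∀ t u, |g t - g u| ≤ K * |t - u| := by
    intro t u
    have h1 := hglip t u
    have h2 := hglip u t
    rw [abs_sub_comm u t] at h2
    exact abs_le.2 ⟨by linarith, by linarith⟩
  have hper : ∀ t, g (t + l + l) = g t := by
    intro t
    refine (Equiv.iInf_congr (e := ((Equiv.addRight (l + l)).subtypeEquiv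
      (fun r => by
        change r ∈ S ↔ r + (l + l) ∈ S
        rw [← add_assoc, hS, hS]))) ?_).symm
    intro r
    have h1 : f ((r : ℝ) + (l + l)) = f r := by
      rw [← add_assoc, hfl _ ((hS r).2 r.2), hfl _ r.2, neg_neg]
    change f ((r : ℝ) + (l + l)) + K * |t + l + l - ((r : ℝ) + (l + l))| = _
    rw [h1]
    congr 3
    ring
  -- Antisymmetrization keeps the Lipschitz constant, leaves `f` unchanged on `S`, and is
  -- antiperiodic because `g` has period `2 l`.
  refine ⟨fun t => (g t - g (t + l)) / 2, ?_, ?_, ?_⟩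
  · intro t ht
    simp only
    rw [hgS t ht, hgS _ ((hS t).2 ht), hfl t ht]
    ring
  · intro t r
    have h1 := abs_le.1 (hglip' t r)
    have h2 := hglip' (t + l) (r + l)
    rw [add_sub_add_right_eq_sub] at h2
    have h3 := abs_le.1 h2
    exact abs_le.2 ⟨by linarith [h1.1, h3.2], by linarith [h1.2, h3.1]⟩
  · intro t
    simp only
    rw [hper]
    ring

/-- The chain rule for the glide reflection. Two maps `F` and `H` are allowed so that it applies
again to the derivatives of an invariant map. -/
theorem dirDeriv_glide {l w : ℝ} {F H : ℝ × ℝ → PaperSpace} (hF : ContDiffOn ℝ ∞ F (openStrip w))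
    (hFH : ∀ p ∈ openStrip w, F (p.1 + l, -p.2) = H p) {p : ℝ × ℝ} (hp : p ∈ openStrip w)
    (v : ℝ × ℝ) : dirDeriv (v.1, -v.2) F (p.1 + l, -p.2) = dirDeriv v H p := by
  rw [← dirDeriv_congr (isOpen_openStrip w) hFH hp]
  have hp' : (p.1 + l, -p.2) ∈ openStrip w := by simpa [openStrip] using hp
  have h1 : HasFDerivAt (fun q : ℝ × ℝ => (q.1 + l, -q.2))
      ((ContinuousLinearMap.fst ℝ ℝ ℝ).prod (-ContinuousLinearMap.snd ℝ ℝ ℝ)) p :=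
    (hasFDerivAt_fst.add_const l).prodMk hasFDerivAt_snd.neg
  have h2 := (hF.differentiableAt_of_isOpen (isOpen_openStrip w) hp').hasFDerivAt.comp p h1
  change _ = fderiv ℝ (F ∘ fun q : ℝ × ℝ => (q.1 + l, -q.2)) p v
  rw [h2.fderiv]
  rfl

/-- The second fundamental form is not zero at `p`, and `(s, 1)` spans its kernel. -/
def IsKernelSlope (G : ℝ × ℝ → PaperSpace) (p : ℝ × ℝ) (s : ℝ) : Prop :=
  dirDeriv (1, 0) (dirDeriv (1, 0) G) p ≠ 0 ∧ dirDeriv (s, 1) (dirDeriv (1, 0) G) p = 0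

theorem isKernelSlope_unique {G : ℝ × ℝ → PaperSpace} {p : ℝ × ℝ} {s r : ℝ} (hs : IsKernelSlope G p s)
    (hr : IsKernelSlope G p r) : s = r := by
  have h1 : ((s, 1) : ℝ × ℝ) = (s - r) • (1, 0) + (r, 1) := by ext <;> simp
  have h2 := hs.2
  rw [h1, dirDeriv_add_left, dirDeriv_smul_left, hr.2, add_zero] at h2
  have h3 := (smul_eq_zero.1 h2).resolve_right hs.1
  linarith

/-- A smooth flat map on the open strip of half-width `w` that is invariant under the glide
reflection of length `l`, that is, a flat open Moebius band in space. -/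
structure IsFlatMoebiusMap (l w : ℝ) (G : ℝ × ℝ → PaperSpace) : Prop where
  length_pos : 0 < l
  width_pos : 0 < w
  flat : IsFlatMap (openStrip w) G
  immersion : ∀ p ∈ openStrip w, ∀ v ≠ 0, dirDeriv v G p ≠ 0
  glide : ∀ x y, G (x + l, -y) = G (x, y)

namespace IsFlatMoebiusMap

variable {l w : ℝ} {G : ℝ × ℝ → PaperSpace} (h : IsFlatMoebiusMap l w G)
include h

theorem dirDeriv_glide_self {p : ℝ × ℝ} (hp : p ∈ openStrip w) (v : ℝ × ℝ) :
    dirDeriv (v.1, -v.2) G (p.1 + l, -p.2) = dirDeriv v G p :=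
  dirDeriv_glide h.flat.smooth (fun p _ => h.glide p.1 p.2) hp v

theorem second_glide {p : ℝ × ℝ} (hp : p ∈ openStrip w) (u v : ℝ × ℝ) :
    dirDeriv (u.1, -u.2) (dirDeriv (v.1, -v.2) G) (p.1 + l, -p.2) =
      dirDeriv u (dirDeriv v G) p :=
  dirDeriv_glide (h.flat.smooth.dirDeriv (isOpen_openStrip w) _)
    (fun _ hq => h.dirDeriv_glide_self hq v) hp u

/-- If the second fundamental form vanishes on horizontal vectors, it vanishes: a horizontal
kernel direction would produce an infinite straight line. -/
theorem second_eq_zero_of_horizontal {p : ℝ × ℝ} (hp : p ∈ openStrip w)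
    (h0 : dirDeriv (1, 0) (dirDeriv (1, 0) G) p = 0) (s : ℝ) :
    dirDeriv (s, 1) (dirDeriv (s, 1) G) p = 0 := by
  have h12 : dirDeriv (1, 0) (dirDeriv (0, 1) G) p = 0 := by
    have := h.flat.gauss_equation hp (1, 0) (0, 1)
    rw [h0, inner_zero_left] at this
    exact inner_self_eq_zero.1 this.symm
  have h22 : dirDeriv (0, 1) (dirDeriv (0, 1) G) p = 0 := by
    by_contra hne
    -- Two glides are the translation by `2 l`. If `G` is affine along this segment and takes the
    -- same value at its ends, its derivative along `ζ` is zero, against immersion.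
    set ζ : ℝ × ℝ := (l + l) • (1, 0) with hζ
    have hseg : ∀ t ∈ Set.Icc (0 : ℝ) 1, p + t • ζ ∈ openStrip w := by
      intro t _
      simpa [openStrip, hζ] using hp
    have hk := h.flat.kernel_on_segment (ζ := ζ) (η := (0, 1)) hseg
      (by rw [hζ, dirDeriv_smul_left, h12, smul_zero]) hne
    have haff := h.flat.eq_add_of_second_eq_zero hseg fun t ht =>
      h.flat.second_self_eq_zero (hseg t ht) (hk t ht).1 (hk t ht).2
    have hper : G (p + ζ) = G p := by
      have h1 := h.glide p.1 p.2
      have h2 := h.glide (p.1 + l) (-p.2)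
      rw [neg_neg, h1] at h2
      rw [← h2]
      congr 1
      ext
      · simp [hζ]
        ring
      · simp [hζ]
    rw [hper] at haff
    refine h.immersion p hp ζ ?_ (by simpa using haff)
    have := h.length_pos
    simp only [hζ, ne_eq, Prod.ext_iff, Prod.smul_fst, smul_eq_mul, Prod.fst_zero]
    intro h'
    have := h'.1
    linarith
  have hs : ((s, 1) : ℝ × ℝ) = s • (1, 0) + (0, 1) := by ext <;> simp
  rw [hs, h.flat.second_add_right hp, h.flat.second_smul_right hp, dirDeriv_add_left,
    dirDeriv_add_left, dirDeriv_smul_left, dirDeriv_smul_left, h0, h12, h22,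
    h.flat.second_comm hp (0, 1), h12]
  simp

/-- All second derivatives are multiples of one vector, so `(1, 0)` and `(0, 1)` give proportional
values and some combination kills them. -/
theorem exists_isKernelSlope {p : ℝ × ℝ} (hp : p ∈ openStrip w)
    (h0 : dirDeriv (1, 0) (dirDeriv (1, 0) G) p ≠ 0) : ∃ s, IsKernelSlope G p s := by
  obtain ⟨n, hn⟩ := h.flat.exists_second_eq_smul hp
  obtain ⟨a, ha⟩ := hn (1, 0) (1, 0)
  obtain ⟨b, hb⟩ := hn (0, 1) (1, 0)
  have ha0 : a ≠ 0 := by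
    rintro rfl
    exact h0 (by rw [ha, zero_smul])
  refine ⟨-(b / a), h0, ?_⟩
  have h1 : ((-(b / a), 1) : ℝ × ℝ) = (-(b / a)) • (1, 0) + (0, 1) := by ext <;> simp
  rw [h1, dirDeriv_add_left, dirDeriv_smul_left, ha, hb, smul_smul, ← add_smul]
  field_simp
  simp

theorem isKernelSlope_glide {p : ℝ × ℝ} (hp : p ∈ openStrip w) {s : ℝ}
    (hs : IsKernelSlope G p s) : IsKernelSlope G (p.1 + l, -p.2) (-s) := by
  have h1 := h.second_glide hp (1, 0) (1, 0)
  have h2 := h.second_glide hp (-s, -1) (1, 0)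
  simp only [neg_zero, neg_neg] at h1 h2
  refine ⟨by rw [h1]; exact hs.1, ?_⟩
  have h3 : ((-s, -1) : ℝ × ℝ) = -(s, 1) := by ext <;> simp
  rw [h2, h3, dirDeriv_neg_left, hs.2, neg_zero]

/-- A kernel direction persists along its own line, which is not horizontal and so reaches every
height of the strip, in particular the axis. -/
theorem isKernelSlope_on_line {x y s : ℝ} (hp : (x, y) ∈ openStrip w)
    (hs : IsKernelSlope G (x, y) s) {z : ℝ} (hz : |z| < w) :
    IsKernelSlope G (x + s * (z - y), z) s := by
  set ζ : ℝ × ℝ := (z - y) • (s, 1) with hζ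
  have hend : (x, y) + ζ = (x + s * (z - y), z) := by
    ext
    · simp [hζ, mul_comm]
    · simp [hζ]
  have hseg : ∀ t ∈ Set.Icc (0 : ℝ) 1, (x, y) + t • ζ ∈ openStrip w := fun t ht =>
    add_smul_mem_openStrip hp (by rw [hend]; exact hz) ht
  have hk := h.flat.kernel_on_segment hseg (ζ := ζ) (η := (1, 0))
    (by rw [hζ, dirDeriv_smul_left, hs.2, smul_zero]) hs.1 1 (by simp)
  rw [one_smul, hend, hζ, dirDeriv_smul_left] at hk
  rcases eq_or_ne (z - y) 0 with h0 | h0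
  · obtain rfl : z = y := by linarith
    simpa using hs
  · exact ⟨hk.2, (smul_eq_zero.1 hk.1).resolve_left h0⟩

/-- Lines with the given slopes that start at points of the axis do not cross in the strip. -/
theorem isKernelSlope_lipschitz {t r s s' : ℝ} (hs : IsKernelSlope G (t, 0) s)
    (hs' : IsKernelSlope G (r, 0) s') : |s - s'| ≤ w⁻¹ * |t - r| := by
  have hw := h.width_pos
  rw [inv_mul_eq_div, le_div_iff₀ hw]
  by_contra! hlt
  have hne : s - s' ≠ 0 := by
    intro h0
    rw [h0, abs_zero, zero_mul] at hlt
    exact absurd hlt (not_lt.2 (abs_nonneg _))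
  -- The height at which the two lines cross. If it lay in the strip, both slopes would be kernel
  -- slopes at the crossing point.
  set y := -(t - r) / (s - s') with hy
  have hyw : |y| < w := by
    rw [hy, abs_div, abs_neg, div_lt_iff₀ (abs_pos.2 hne)]
    linarith
  have hys : (s - s') * y = -(t - r) := by
    rw [hy]
    field_simp
  have h0 : ∀ x : ℝ, (x, (0 : ℝ)) ∈ openStrip w := fun x => by simpa [openStrip] using hw
  have k1 := h.isKernelSlope_on_line (h0 t) hs hyw
  have k2 := h.isKernelSlope_on_line (h0 r) hs' hyw
  have hpt : t + s * (y - 0) = r + s' * (y - 0) := by linarith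
  rw [hpt] at k1
  exact hne (sub_eq_zero.2 (isKernelSlope_unique k1 k2))

/-- A flat Moebius band is swept out by straight segments that cross the strip and are pairwise
disjoint. -/
theorem exists_ruling : ∃ (s : ℝ → ℝ) (A : ℝ → PaperSpace),
    (∀ t r, |s t - s r| ≤ w⁻¹ * |t - r|) ∧ Continuous A ∧ (∀ t, A t ≠ 0) ∧
    (∀ t, s (t + l) = -s t) ∧ (∀ t, A (t + l) = -A t) ∧
    ∀ t y, |y| < w → G (t + s t * y, y) = G (t, 0) + y • A t := by
  have hw := h.width_pos
  have h0 : ∀ x : ℝ, (x, (0 : ℝ)) ∈ openStrip w := fun x => by simpa [openStrip] using hw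
  set S : Set ℝ := {t | dirDeriv (1, 0) (dirDeriv (1, 0) G) (t, 0) ≠ 0} with hS
  have hex : ∀ t, ∃ s, t ∈ S → IsKernelSlope G (t, 0) s := by
    intro t
    by_cases ht : t ∈ S
    · obtain ⟨s, hs⟩ := h.exists_isKernelSlope (h0 t) ht
      exact ⟨s, fun _ => hs⟩
    · exact ⟨0, fun h' => absurd h' ht⟩
  choose f hf using hex
  have hSl : ∀ t, t + l ∈ S ↔ t ∈ S := by
    intro t
    have := h.second_glide (h0 t) (1, 0) (1, 0)
    simp only [neg_zero] at this
    simp only [hS, Set.mem_ofPred_eq, this]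
  -- The slope is determined only over non-flat points of the axis; any antiperiodic Lipschitz
  -- extension serves over the rest.
  obtain ⟨s, hsf, hslip, hsl⟩ := exists_lipschitz_antiperiodic_extension (S := S) (f := f)
    (K := w⁻¹) (l := l) (by positivity)
    (fun t ht r hr => h.isKernelSlope_lipschitz (hf t ht) (hf r hr)) hSl
    (fun t ht => by
      have := h.isKernelSlope_glide (h0 t) (hf t ht)
      simp only [neg_zero] at this
      exact isKernelSlope_unique (hf _ ((hSl t).2 ht)) this)
  have hsc : Continuous s := by
    refine (LipschitzWith.of_dist_le_mul (K := ⟨w⁻¹, by positivity⟩) fun t r => ?_).continuous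
    rw [Real.dist_eq, Real.dist_eq]
    exact hslip t r
  have haxis : Continuous fun t : ℝ => ((t, 0) : ℝ × ℝ) := by fun_prop
  refine ⟨s, fun t => dirDeriv (s t, 1) G (t, 0), hslip, ?_, ?_, hsl, ?_, ?_⟩
  · have hexp : (fun t => dirDeriv (s t, 1) G (t, 0)) =
        fun t => s t • dirDeriv (1, 0) G (t, 0) + dirDeriv (0, 1) G (t, 0) := by
      funext t
      rw [← dirDeriv_smul_left, ← dirDeriv_add_left]
      simp
    have hc : ∀ v, Continuous fun t : ℝ => dirDeriv v G (t, 0) := fun v =>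
      (h.flat.smooth.dirDeriv h.flat.isOpen v).continuousOn.comp_continuous haxis h0
    rw [hexp]
    exact (hsc.smul (hc _)).add (hc _)
  · intro t
    exact h.immersion _ (h0 t) _ (by simp)
  · intro t
    have h1 := h.dirDeriv_glide_self (h0 t) (-s t, -1)
    have h3 : ((-s t, -1) : ℝ × ℝ) = -(s t, 1) := by ext <;> simp
    simp only [neg_zero, neg_neg] at h1
    simp only
    rw [hsl, h1, h3, dirDeriv_neg_left]
  · intro t y hy
    set ζ : ℝ × ℝ := y • (s t, 1) with hζ
    have hend : (t, 0) + ζ = (t + s t * y, y) := by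
      ext
      · simp [hζ, mul_comm]
      · simp [hζ]
    have hseg : ∀ τ ∈ Set.Icc (0 : ℝ) 1, (t, 0) + τ • ζ ∈ openStrip w := fun τ hτ =>
      add_smul_mem_openStrip (h0 t) (by rw [hend]; exact hy) hτ
    have key := h.flat.eq_add_of_second_eq_zero hseg ?_
    · rw [← hend, key, hζ, dirDeriv_smul_left]
    intro τ hτ
    have hq := hseg τ hτ
    have hqe : (t, 0) + τ • ζ = (t + s t * (τ * y), τ * y) := by
      ext
      · simp [hζ]
        ring
      · simp [hζ]
    rw [hqe] at hq ⊢
    rw [hζ, dirDeriv_smul_left, h.flat.second_smul_right hq]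
    suffices dirDeriv (s t, 1) (dirDeriv (s t, 1) G) (t + s t * (τ * y), τ * y) = 0 by
      rw [this, smul_zero, smul_zero]
    -- At a non-flat point the kernel line runs back to the axis at some `r`, with slope `s r`. The
    -- Lipschitz bound forbids the lines of `t` and `r` to meet in the strip unless `t = r`, so the
    -- given line is the kernel line.
    by_cases hne : dirDeriv (1, 0) (dirDeriv (1, 0) G) (t + s t * (τ * y), τ * y) = 0
    · exact h.second_eq_zero_of_horizontal hq hne _
    · obtain ⟨σ, hσ⟩ := h.exists_isKernelSlope hq hne
      have hax := h.isKernelSlope_on_line hq hσ (z := 0) (by simpa using hw)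
      set r := t + s t * (τ * y) + σ * (0 - τ * y) with hr
      have hrS : r ∈ S := hax.1
      have hsr : s r = σ := by
        rw [hsf r hrS]
        exact isKernelSlope_unique (hf r hrS) hax
      have htr : t = r := by
        refine eq_of_lines_meet hw (hslip t r) hq ?_
        rw [hsr, hr]
        ring
      rw [← htr] at hsr
      rw [← hsr] at hσ
      exact h.flat.second_self_eq_zero hq hσ.2 hσ.1

end IsFlatMoebiusMap

/-! ### Perpendicular meeting lines by a winding argument. -/

/-- A symmetric continuous map from the plane to the complex numbers that is antiperiodic in each
variable and takes positive values on the diagonal has a zero. -/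
theorem exists_zero_of_symmetric_antiperiodic {F : ℝ × ℝ → ℂ} (hF : Continuous F) {l : ℝ}
    (hsymm : ∀ x y, F (y, x) = F (x, y)) (hanti : ∀ x y, F (x, y + l) = -F (x, y))
    (hdiag : ∀ x, ∃ r : ℝ, 0 < r ∧ F (x, x) = r) : ∃ x y, F (x, y) = 0 := by
  by_contra! hne
  obtain ⟨e₀, he₀⟩ : ∃ e : ℂ, Complex.exp e = F (0, 0) := ⟨_, Complex.exp_log (hne 0 0)⟩
  obtain ⟨L, ⟨-, hL⟩, -⟩ := Complex.isCoveringMapOn_exp.existsUnique_continuousMap_lifts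
    (⟨F, hF⟩ : C(ℝ × ℝ, ℂ)) (a₀ := (0, 0)) he₀ (fun a => hne a.1 a.2)
  have hexp : ∀ p, Complex.exp (L p) = F p := fun p => congrFun hL p
  have hneg : ∀ z w : ℂ, Complex.exp (z - w) = Complex.exp z / Complex.exp w := Complex.exp_sub
  have cov := Complex.isCoveringMap_exp
  -- Each combination of logarithms below has constant exponential (`-1`, `1`, `1`), so it is
  -- constant by discreteness of the fibres of `exp`.
  have hshift := cov.const_of_comp (g := fun p : ℝ × ℝ => L (p.1, p.2 + l) - L p) (by fun_prop)
    (fun p q => Subtype.ext (by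
      simp only [hneg, hexp]
      rw [hanti, hanti, neg_div, neg_div, div_self (hne _ _), div_self (hne _ _)]))
  have hswap := cov.const_of_comp (g := fun p : ℝ × ℝ => L (p.2, p.1) - L p) (by fun_prop)
    (fun p q => Subtype.ext (by
      simp only [hneg, hexp]
      rw [hsymm p.1 p.2, hsymm q.1 q.2, div_self (hne _ _), div_self (hne _ _)]))
  have hone : ∀ x, Complex.exp (L (x, x) - (L (x, x)).re) = 1 := by
    intro x
    obtain ⟨r, hr, hrx⟩ := hdiag x
    have h1 : Real.exp (L (x, x)).re = r := by
      rw [← Complex.norm_exp, hexp, hrx]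
      simp [abs_of_pos hr]
    rw [hneg, hexp, hrx, ← Complex.ofReal_exp, h1, div_self]
    exact_mod_cast hr.ne'
  have hreal := cov.const_of_comp (g := fun x : ℝ => L (x, x) - (L (x, x)).re) (by fun_prop)
    (fun x y => Subtype.ext (by simp only [hone])) 0 l
  have h1 := hshift (0, 0) (l, 0)
  have h2 := hswap (0, 0) (0, l)
  simp only [zero_add, sub_self] at h1 h2
  set d := L (0, l) - L (0, 0) with hd
  -- By the symmetry, `d` is the increment of `L` in either variable. The imaginary part of `L` is
  -- constant on the diagonal, so `d` is real, while `exp d = -1`.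
  have h3 : L (l, l) = L (0, 0) + 2 * d := by linear_combination -h1 - h2 + hd
  have hdim : d.im = 0 := by
    have h4 := congrArg Complex.im hreal
    rw [h3] at h4
    simp at h4
    exact h4
  have h5 : Complex.exp d = -1 := by
    have := hanti 0 0
    rw [zero_add] at this
    rw [hd, hneg, hexp, hexp, this, neg_div, div_self (hne _ _)]
  have h6 : d = (d.re : ℂ) := by
    apply Complex.ext <;> simp [hdim]
  rw [h6, ← Complex.ofReal_exp] at h5
  have h7 : Real.exp d.re = -1 := by exact_mod_cast h5
  linarith [Real.exp_pos d.re]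

/-- The determinant of three vectors in space. -/
def tripleProduct (a b c : PaperSpace) : ℝ := (Matrix.of ![a.ofLp, b.ofLp, c.ofLp]).det

theorem tripleProduct_eq (a b c : PaperSpace) : tripleProduct a b c =
    a 0 * b 1 * c 2 - a 0 * b 2 * c 1 - a 1 * b 0 * c 2 + a 1 * b 2 * c 0 + a 2 * b 0 * c 1
      - a 2 * b 1 * c 0 := by
  simp [tripleProduct, Matrix.det_fin_three]

theorem exists_eq_add_of_tripleProduct_eq_zero {a b c : PaperSpace}
    (hbc : LinearIndependent ℝ ![b, c]) (h : tripleProduct a b c = 0) :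
    ∃ α β : ℝ, a = α • b + β • c := by
  by_contra! hne
  have hli : LinearIndependent ℝ ![a, b, c] := by
    refine linearIndependent_finCons.2 ⟨hbc, fun hmem => ?_⟩
    rw [Matrix.range_cons, Matrix.range_cons, Matrix.range_empty, Set.union_empty,
      Set.singleton_union, Submodule.mem_span_pair] at hmem
    obtain ⟨α, β, hαβ⟩ := hmem
    exact hne α β hαβ.symm
  have hli' := hli.map' (WithLp.linearEquiv 2 ℝ (Fin 3 → ℝ)).toLinearMap (LinearEquiv.ker _)
  have hrows : (Matrix.of ![a.ofLp, b.ofLp, c.ofLp]).row =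
      (WithLp.linearEquiv 2 ℝ (Fin 3 → ℝ)).toLinearMap ∘ ![a, b, c] := by
    funext i
    fin_cases i <;> rfl
  rw [← hrows, Matrix.linearIndependent_rows_iff_isUnit, Matrix.isUnit_iff_isUnit_det] at hli'
  exact hli'.ne_zero h

/-- In a one-parameter family of lines that returns to the first line with its direction reversed,
two lines are perpendicular and meet. -/
theorem exists_perpendicular_meeting_lines {m A : ℝ → PaperSpace} (hm : Continuous m)
    (hA : Continuous A) (hA0 : ∀ t, A t ≠ 0) {l : ℝ} (hml : ∀ t, m (t + l) = m t)
    (hAl : ∀ t, A (t + l) = -A t) :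
    ∃ x y, inner ℝ (A x) (A y) = 0 ∧ ∃ α β : ℝ, m x + α • A x = m y + β • A y := by
  -- A zero of the real part means perpendicular, and of the imaginary part coplanar; coplanar lines
  -- that are not parallel meet. Exchanging `x` and `y` flips the determinant twice.
  set F : ℝ × ℝ → ℂ := fun p => (inner ℝ (A p.1) (A p.2) : ℝ) +
      (tripleProduct (m p.1 - m p.2) (A p.1) (A p.2) : ℝ) * Complex.I with hF
  have hzero : ∃ x y, F (x, y) = 0 := by
    refine exists_zero_of_symmetric_antiperiodic (l := l) ?_ ?_ ?_ ?_
    · simp only [hF, tripleProduct_eq]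
      fun_prop
    · intro x y
      simp only [hF, tripleProduct_eq, real_inner_comm]
      congr 3
      simp only [PiLp.sub_apply]
      ring
    · intro x y
      simp only [hF, tripleProduct_eq, hml, hAl, inner_neg_right, PiLp.neg_apply]
      push_cast
      ring
    · intro x
      refine ⟨inner ℝ (A x) (A x), real_inner_self_pos.2 (hA0 x), ?_⟩
      simp [hF, tripleProduct_eq]
  obtain ⟨x, y, hxy⟩ := hzero
  have h1 := congrArg Complex.re hxy
  have h2 := congrArg Complex.im hxy
  simp [hF] at h1 h2
  refine ⟨x, y, h1, ?_⟩
  have hli : LinearIndependent ℝ ![A x, A y] := by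
    refine linearIndependent_of_ne_zero_of_inner_eq_zero (𝕜 := ℝ) ?_ ?_
    · intro i
      fin_cases i
      · exact hA0 x
      · exact hA0 y
    · intro i j hij
      fin_cases i <;> fin_cases j
      · exact absurd rfl hij
      · exact h1
      · exact (real_inner_comm _ _).trans h1
      · exact absurd rfl hij
  obtain ⟨α, β, h3⟩ := exists_eq_add_of_tripleProduct_eq_zero hli h2
  refine ⟨-α, β, ?_⟩
  rw [sub_eq_iff_eq_add] at h3
  rw [h3, neg_smul]
  abel

/-! ### From rulings to bends and T-patterns. -/

/-- The segment centred at `m` with direction and length given by `v`. -/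
def centeredSegment (m v : PaperSpace) : Set PaperSpace :=
  segment ℝ (m - (1 / 2 : ℝ) • v) (m + (1 / 2 : ℝ) • v)

theorem exists_of_mem_centeredSegment {m v z : PaperSpace} (hz : z ∈ centeredSegment m v) :
    ∃ y : ℝ, |y| ≤ 1 / 2 ∧ z = m + y • v := by
  rw [centeredSegment, segment_eq_image] at hz
  obtain ⟨θ, hθ, rfl⟩ := hz
  refine ⟨θ - 1 / 2, abs_le.2 ⟨by linarith [hθ.1], by linarith [hθ.2]⟩, ?_⟩
  simp only
  module

theorem exists_of_mem_openSegment_centered {m v z : PaperSpace}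
    (hz : z ∈ openSegment ℝ (m - (1 / 2 : ℝ) • v) (m + (1 / 2 : ℝ) • v)) :
    ∃ y : ℝ, |y| < 1 / 2 ∧ z = m + y • v := by
  rw [openSegment_eq_image] at hz
  obtain ⟨θ, hθ, rfl⟩ := hz
  refine ⟨θ - 1 / 2, abs_lt.2 ⟨by linarith [hθ.1], by linarith [hθ.2]⟩, ?_⟩
  simp only
  module

theorem direction_affineSpan_centeredSegment (m v : PaperSpace) :
    (affineSpan ℝ (centeredSegment m v)).direction = Submodule.span ℝ {v} := by
  rw [direction_affineSpan, centeredSegment, vectorSpan_segment]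
  have h' : (m + (1 / 2 : ℝ) • v) - (m - (1 / 2 : ℝ) • v) = v := by module
  rw [vsub_eq_sub, h']

theorem add_smul_mem_affineSpan_centeredSegment (m v : PaperSpace) (α : ℝ) :
    m + α • v ∈ affineSpan ℝ (centeredSegment m v) := by
  have h := AffineMap.lineMap_mem (α + 1 / 2)
    (subset_affineSpan ℝ _ (left_mem_segment ℝ (m - (1 / 2 : ℝ) • v) (m + (1 / 2 : ℝ) • v)))
    (subset_affineSpan ℝ _ (right_mem_segment ℝ (m - (1 / 2 : ℝ) • v) (m + (1 / 2 : ℝ) • v)))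
  rw [AffineMap.lineMap_apply_module] at h
  have he : m + α • v = (1 - (α + 1 / 2)) • (m - (1 / 2 : ℝ) • v) +
      (α + 1 / 2) • (m + (1 / 2 : ℝ) • v) := by module
  rw [he]
  exact h

theorem antiperiodic_add_int_mul {V : Type*} [AddCommGroup V] [Module ℝ V] {f : ℝ → V} {l : ℝ}
    (hf : ∀ t, f (t + l) = -f t) (t : ℝ) (k : ℤ) : f (t + k * l) = (-1 : ℝ) ^ k • f t := by
  induction k using Int.induction_on with
  | zero => simp
  | succ n ih =>
    have : t + ((n + 1 : ℤ) : ℝ) * l = t + ((n : ℤ) : ℝ) * l + l := by push_cast; ring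
    rw [this, hf, ih, zpow_add₀ (by norm_num), zpow_one, mul_neg_one, neg_smul]
  | pred n ih =>
    have : t + ((-n : ℤ) : ℝ) * l = t + ((-n - 1 : ℤ) : ℝ) * l + l := by push_cast; ring
    rw [this, hf] at ih
    rw [← neg_neg (f _), ih, zpow_sub₀ (by norm_num), zpow_one, div_neg, div_one, neg_smul]

theorem mem_paperStrip_Icc {x y : ℝ} (hy : |y| ≤ 1 / 2) :
    (!₂[x, y + 1 / 2] : PaperPlane) ∈ paperStrip (Set.Icc 0 1) := by
  have := abs_le.1 hy
  simp only [paperStrip, Set.mem_ofPred_eq, Set.mem_Icc]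
  constructor
  · simp; linarith
  · simp; linarith

theorem mk_eq_mk_iff {l : ℝ} {s : Set ℝ} {p q : paperStrip s} :
    FlatMoebius.mk l s p = FlatMoebius.mk l s q ↔
      ∃ k : ℤ, q.1 0 = p.1 0 + k * l ∧ q.1 1 - 1 / 2 = (-1 : ℝ) ^ k * (p.1 1 - 1 / 2) :=
  Quotient.eq

/-- Glides preserve the distance to the core, so every representative of a boundary point lies on an
edge of the strip. -/
theorem abs_eq_of_mem_boundary {l : ℝ} {p : paperStrip (Set.Icc 0 1)}
    (h : FlatMoebius.mk l _ p ∈ MoebiusBand.boundary l) : |p.1 1 - 1 / 2| = 1 / 2 := by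
  obtain ⟨q, hq, hqp⟩ := h
  obtain ⟨k, -, hk⟩ := mk_eq_mk_iff.1 hqp
  rw [hk, abs_mul, abs_neg_one_zpow, one_mul]
  rcases hq with h | h <;> rw [h] <;> norm_num [abs_of_pos, abs_of_neg]

section TPattern

variable {l w : ℝ} {G : ℝ × ℝ → PaperSpace} {I : MoebiusBand l → PaperSpace}

/-- A straight segment in the flat band that crosses the strip, and on which the map is affine, is
mapped to a bend. -/
theorem isBend_centeredSegment
    (hI : ∀ (p : PaperPlane) (hp : p ∈ paperStrip (Set.Icc 0 1)),
      I (FlatMoebius.mk l _ ⟨p, hp⟩) = G (p 0, p 1 - 1 / 2))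
    {t s : ℝ} {m v : PaperSpace} (hv : v ≠ 0)
    (haff : ∀ y, |y| ≤ 1 / 2 → G (t + s * y, y) = m + y • v) :
    IsBend I (centeredSegment m v) := by
  have hval : ∀ (y : ℝ) (hy : |y| ≤ 1 / 2),
      I (FlatMoebius.mk l _ ⟨!₂[t + s * y, y + 1 / 2], mem_paperStrip_Icc hy⟩) = m + y • v := by
    intro y hy
    rw [hI, ← haff y hy]
    simp
  refine ⟨m - (1 / 2 : ℝ) • v, m + (1 / 2 : ℝ) • v, ?_, rfl, ?_, ?_, ?_⟩
  · intro h
    apply hv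
    have : v = (m + (1 / 2 : ℝ) • v) - (m - (1 / 2 : ℝ) • v) := by module
    rw [this, h, sub_self]
  · have h1 : |(-(1 / 2) : ℝ)| ≤ 1 / 2 := by norm_num [abs_of_pos]
    refine ⟨_, ⟨_, ?_, rfl⟩, (hval (-(1 / 2)) h1).trans (by module)⟩
    left
    simp
  · have h1 : |(1 / 2 : ℝ)| ≤ 1 / 2 := by norm_num [abs_of_pos]
    refine ⟨_, ⟨_, ?_, rfl⟩, hval (1 / 2) h1⟩
    right
    simp
    norm_num
  · intro z hz
    obtain ⟨y, hy, rfl⟩ := exists_of_mem_openSegment_centered hz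
    refine ⟨_, fun hb => ?_, hval y hy.le⟩
    have := abs_eq_of_mem_boundary hb
    simp at this
    rw [this] at hy
    norm_num at hy

/-- A flat Moebius band of width at least `1` has a T-pattern made of two segments that meet at
most at points whose height is at least the half-width of the strip. -/
theorem exists_isTPattern (h : IsFlatMoebiusMap l w G) (hw : 1 / 2 ≤ w)
    (hcont : ContinuousOn G {p | |p.2| ≤ 1 / 2})
    (hI : ∀ (p : PaperPlane) (hp : p ∈ paperStrip (Set.Icc 0 1)),
      I (FlatMoebius.mk l _ ⟨p, hp⟩) = G (p 0, p 1 - 1 / 2)) (hinj : Function.Injective I) :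
    ∃ T B : Set PaperSpace, IsTPattern I T B ∧
      ∀ z ∈ T ∩ B, ∃ p : paperStrip (Set.Icc 0 1),
        w ≤ |p.1 1 - 1 / 2| ∧ I (FlatMoebius.mk l _ p) = z := by
  obtain ⟨s, A, hslip, hAc, hA0, hsl, hAl, hG⟩ := h.exists_ruling
  have haff : ∀ t y, |y| ≤ 1 / 2 → G (t + s t * y, y) = G (t, 0) + y • A t := by
    intro t
    -- When `w = 1/2` the ruling is affine only on the open strip; continuity carries this to the
    -- endpoints.
    have heq : Set.EqOn (fun y => G (t + s t * y, y)) (fun y => G (t, 0) + y • A t)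
        (Set.Ioo (-(1 / 2)) (1 / 2)) := fun y hy =>
      hG t y ((abs_lt.2 hy).trans_le hw)
    have hclos := heq.of_subset_closure (t := Set.Icc (-(1 / 2)) (1 / 2))
      (hcont.comp (by fun_prop) fun y hy => abs_le.2 hy) (by fun_prop)
      Set.Ioo_subset_Icc_self (by rw [closure_Ioo (by norm_num)])
    exact fun y hy => hclos (abs_le.1 hy)
  have haxis : Continuous fun t : ℝ => G (t, 0) :=
    hcont.comp_continuous (by fun_prop) fun t => by simp
  obtain ⟨t, r, hperp, α, β, hmeet⟩ := exists_perpendicular_meeting_lines haxis hAc hA0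
    (fun t => by simpa using h.glide t 0) hAl
  refine ⟨centeredSegment (G (t, 0)) (A t), centeredSegment (G (r, 0)) (A r),
    ⟨isBend_centeredSegment hI (hA0 t) (haff t), isBend_centeredSegment hI (hA0 r)
      (haff r), ?_, ?_⟩, ?_⟩
  · rw [direction_affineSpan_centeredSegment, direction_affineSpan_centeredSegment,
      Submodule.isOrtho_span]
    rintro _ rfl _ rfl
    exact hperp
  · refine ⟨_, add_smul_mem_affineSpan_centeredSegment _ _ α, ?_⟩
    rw [hmeet]
    exact add_smul_mem_affineSpan_centeredSegment _ _ β
  · rintro z ⟨hzt, hzr⟩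
    obtain ⟨y, hy, rfl⟩ := exists_of_mem_centeredSegment hzt
    obtain ⟨y', hy', hz⟩ := exists_of_mem_centeredSegment hzr
    have hP : I (FlatMoebius.mk l _ ⟨!₂[t + s t * y, y + 1 / 2], mem_paperStrip_Icc hy⟩) =
        G (t, 0) + y • A t := by
      rw [hI, ← haff t y hy]
      simp
    have hQ : I (FlatMoebius.mk l _ ⟨!₂[r + s r * y', y' + 1 / 2], mem_paperStrip_Icc hy'⟩) =
        G (r, 0) + y' • A r := by
      rw [hI, ← haff r y' hy']
      simp
    refine ⟨_, ?_, hP⟩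
    simp only [Matrix.cons_val_one, Matrix.cons_val_zero, add_sub_cancel_right]
    -- By injectivity the two preimages differ by the `k`-th glide. The ruling of `r` then meets
    -- that of `t + k l` below height `w`, so `r = t + k l` and `A r = ± A t`, against
    -- perpendicularity.
    by_contra! hlt
    obtain ⟨k, hk0, hk1⟩ := mk_eq_mk_iff.1 (hinj (hP.trans (hz.trans hQ.symm)))
    simp at hk0 hk1
    have hlt' : |y'| < w := by
      rw [hk1, abs_mul, abs_neg_one_zpow, one_mul]
      exact hlt
    have hsk := antiperiodic_add_int_mul hsl t k
    have hsq : (-1 : ℝ) ^ k * (-1 : ℝ) ^ k = 1 := by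
      rw [← mul_zpow]
      norm_num
    have hrt : r = t + k * l := by
      refine eq_of_lines_meet h.width_pos (hslip r (t + k * l)) hlt' ?_
      rw [hk0, hsk, hk1, smul_eq_mul]
      linear_combination (-(s t * y)) * hsq
    rw [hrt, antiperiodic_add_int_mul hAl t k, inner_smul_right] at hperp
    rcases mul_eq_zero.1 hperp with h0 | h0
    · exact zpow_ne_zero k (by norm_num) h0
    · exact hA0 t (inner_self_eq_zero.1 h0)

end TPattern

/-! ### Speed from arc length. -/

section ArcLength

theorem eVariationOn_Icc_le_of_lipschitzOnWith {V : Type*} [PseudoEMetricSpace V] {f : ℝ → V} {a b : ℝ} (hab : a ≤ b) {C : NNReal}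
    (hf : LipschitzOnWith C f (Set.Icc a b)) :
    eVariationOn f (Set.Icc a b) ≤ C * ENNReal.ofReal (b - a) := by
  have h1 := hf.comp_eVariationOn_le (g := id) (Set.mapsTo_id (Set.Icc a b))
  have h2 := (monotone_id.monotoneOn (Set.Icc a b)).eVariationOn_eq
    (Set.left_mem_Icc.2 hab) (Set.right_mem_Icc.2 hab)
  rw [Set.inter_self] at h2
  exact h1.trans (mul_le_mul_right h2.le _)

variable {V : Type*} [NormedAddCommGroup V] [NormedSpace ℝ V]

theorem eVariationOn_line (p v : V) {a b : ℝ} (hab : a ≤ b) :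
    eVariationOn (fun t : ℝ => p + t • v) (Set.Icc a b) = ‖v‖₊ * ENNReal.ofReal (b - a) := by
  have hdist : ∀ s t : ℝ, dist (p + s • v) (p + t • v) = ‖v‖ * dist s t := by
    intro s t
    rw [dist_add_left, dist_eq_norm, ← sub_smul, norm_smul, mul_comm, Real.dist_eq,
      Real.norm_eq_abs]
  refine le_antisymm ?_ ?_
  · refine eVariationOn_Icc_le_of_lipschitzOnWith hab ?_
    exact (LipschitzWith.of_dist_le_mul fun s t => (hdist s t).le).lipschitzOnWith
  · refine le_trans ?_ (eVariationOn.edist_le _ (Set.right_mem_Icc.2 hab) (Set.left_mem_Icc.2 hab))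
    rw [edist_dist, hdist, Real.dist_eq, abs_of_nonneg (by linarith),
      ENNReal.ofReal_mul (norm_nonneg _), ofReal_norm]
    rfl

/-- A continuously differentiable curve whose arc length grows at a constant rate has this rate as
its speed. -/
theorem norm_deriv_eq_of_eVariationOn {γ γ' : ℝ → V} {δ : ℝ} (hδ : 0 < δ) {N : NNReal}
    (hd : ∀ t ∈ Set.Ioo (-δ) δ, HasDerivAt γ (γ' t) t) (hc : ContinuousAt γ' 0)
    (hvar : ∀ a b, -δ < a → a ≤ b → b < δ →
      eVariationOn γ (Set.Icc a b) = N * ENNReal.ofReal (b - a)) :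
    ‖γ' 0‖ = N := by
  have h0 : (0 : ℝ) ∈ Set.Ioo (-δ) δ := ⟨by linarith, hδ⟩
  refine le_antisymm ?_ ?_
  · have hlip : ∀ᶠ t in nhds (0 : ℝ), ‖γ t - γ 0‖ ≤ N * ‖t - 0‖ := by
      filter_upwards [Ioo_mem_nhds h0.1 h0.2] with t ht
      have key : ∀ a b, -δ < a → a ≤ b → b < δ → dist (γ a) (γ b) ≤ N * (b - a) := by
        intro a b ha hab hb
        have h1 := eVariationOn.edist_le γ (Set.left_mem_Icc.2 hab) (Set.right_mem_Icc.2 hab)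
        have hba : 0 ≤ b - a := by linarith
        rw [hvar a b ha hab hb, edist_dist, ← ENNReal.ofReal_coe_nnreal,
          ← ENNReal.ofReal_mul N.coe_nonneg] at h1
        exact (ENNReal.ofReal_le_ofReal_iff (by positivity)).1 h1
      rw [← dist_eq_norm, ← dist_eq_norm, Real.dist_eq]
      rcases le_total 0 t with h | h
      · rw [dist_comm, sub_zero, abs_of_nonneg h]
        simpa using key 0 t h0.1 h ht.2
      · rw [sub_zero, abs_of_nonpos h]
        simpa using key t 0 ht.1 h h0.2
    have h1 := (hd 0 h0).hasFDerivAt.le_of_lip' N.coe_nonneg hlip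
    simpa using h1
  -- A speed below `N` at `0` would stay below some `k < N` nearby, and the arc over `[0, b]` would
  -- be too short.
  · by_contra! hlt
    obtain ⟨k, hk1, hk2⟩ := exists_between hlt
    have hk0 : 0 ≤ k := (norm_nonneg _).trans hk1.le
    lift k to NNReal using hk0
    obtain ⟨η, hη, hball⟩ := Metric.eventually_nhds_iff_ball.1
      (((hc.norm.eventually_lt continuousAt_const hk1)).and (Ioo_mem_nhds h0.1 h0.2))
    set b := η / 2 with hb
    have hb0 : 0 < b := by positivity
    have hmem : ∀ t ∈ Set.Icc 0 b, ‖γ' t‖ < k ∧ t ∈ Set.Ioo (-δ) δ := by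
      intro t ht
      refine hball t ?_
      rw [Metric.mem_ball, Real.dist_eq, sub_zero, abs_of_nonneg ht.1]
      linarith [ht.2]
    have hL : LipschitzOnWith k γ (Set.Icc 0 b) :=
      (convex_Icc 0 b).lipschitzOnWith_of_nnnorm_hasDerivWithin_le
        (fun t ht => (hd t (hmem t ht).2).hasDerivWithinAt) (fun t ht => (hmem t ht).1.le)
    have h1 := eVariationOn_Icc_le_of_lipschitzOnWith hb0.le hL
    rw [hvar 0 b h0.1 hb0.le (hmem b ⟨hb0.le, le_rfl⟩).2.2, ← ENNReal.ofReal_coe_nnreal,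
      ← ENNReal.ofReal_coe_nnreal, ← ENNReal.ofReal_mul N.coe_nonneg, ← ENNReal.ofReal_mul k.coe_nonneg,
      ENNReal.ofReal_le_ofReal_iff (by rw [sub_zero]; positivity), sub_zero] at h1
    exact absurd (le_of_mul_le_mul_right h1 hb0) (not_le.2 hk2)

end ArcLength

/-! ### The lift of a paper band is a flat Moebius map. -/

/-- The point of the plane at horizontal coordinate `q.1` and height `q.2` above the core of the
band. -/
noncomputable def planePoint (q : ℝ × ℝ) : PaperPlane := !₂[q.1, q.2 + 1 / 2]

/-- The vector of the plane with the given coordinates. -/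
noncomputable def planeVector (v : ℝ × ℝ) : PaperPlane := !₂[v.1, v.2]

theorem planePoint_add (q v : ℝ × ℝ) : planePoint (q + v) = planePoint q + planeVector v := by
  ext i
  fin_cases i
  · simp [planePoint, planeVector]
  · simp [planePoint, planeVector]
    ring

theorem planeVector_add (v w : ℝ × ℝ) : planeVector (v + w) = planeVector v + planeVector w := by
  ext i
  fin_cases i <;> simp [planeVector]

theorem planeVector_smul (c : ℝ) (v : ℝ × ℝ) : planeVector (c • v) = c • planeVector v := by
  ext i
  fin_cases i <;> simp [planeVector]

theorem planeVector_eq_zero {v : ℝ × ℝ} (h : planeVector v = 0) : v = 0 := by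
  have h0 := congrFun (congrArg WithLp.ofLp h) 0
  have h1 := congrFun (congrArg WithLp.ofLp h) 1
  simp [planeVector] at h0 h1
  exact Prod.ext h0 h1

theorem contDiff_planePoint : ContDiff ℝ ∞ planePoint := by
  rw [contDiff_euclidean]
  intro i
  fin_cases i
  · simpa [planePoint] using contDiff_fst
  · simpa [planePoint] using contDiff_snd.add contDiff_const

theorem planePoint_mem {s : Set ℝ} {q : ℝ × ℝ} :
    planePoint q ∈ paperStrip s ↔ q.2 + 1 / 2 ∈ s := by
  simp [planePoint, paperStrip]

theorem planePoint_eq (p : PaperPlane) : planePoint (p 0, p 1 - 1 / 2) = p := by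
  ext i
  fin_cases i <;> simp [planePoint]

section Lift

variable {l : ℝ} {s : Set ℝ}

open Classical in
/-- The map on the strip covered by a map on the flat Moebius band, with heights measured from the
core of the band. -/
noncomputable def bandLift (f : FlatMoebius l s → PaperSpace) (q : ℝ × ℝ) : PaperSpace :=
  -- The constant value outside the strip keeps the lift glide-invariant on the whole plane.
  if h : planePoint q ∈ paperStrip s then f (FlatMoebius.mk l s ⟨planePoint q, h⟩) else 0

theorem bandLift_of_mem (f : FlatMoebius l s → PaperSpace) {q : ℝ × ℝ}
    (h : planePoint q ∈ paperStrip s) :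
    bandLift f q = f (FlatMoebius.mk l s ⟨planePoint q, h⟩) := dif_pos h

theorem bandLift_glide (f : FlatMoebius l s → PaperSpace)
    (hs : ∀ y : ℝ, -y + 1 / 2 ∈ s ↔ y + 1 / 2 ∈ s) (x y : ℝ) :
    bandLift f (x + l, -y) = bandLift f (x, y) := by
  by_cases h : planePoint (x, y) ∈ paperStrip s
  · have h' : planePoint (x + l, -y) ∈ paperStrip s := by
      rw [planePoint_mem] at h ⊢
      exact (hs y).2 h
    rw [bandLift_of_mem f h, bandLift_of_mem f h']
    congr 1
    exact (mk_eq_mk_iff.2 ⟨1, by simp [planePoint], by simp [planePoint]⟩).symm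
  · have h' : planePoint (x + l, -y) ∉ paperStrip s := by
      rw [planePoint_mem] at h ⊢
      exact fun h' => h ((hs y).1 h')
    rw [bandLift, bandLift, dif_neg h, dif_neg h']

variable {f : FlatMoebius l s → PaperSpace}

/-- Up to the edges, where the local smooth extensions agree with the lift only inside the strip;
continuity within it is enough to close up the rulings. -/
theorem IsSmoothOnBand.continuousOn_bandLift (hf : IsSmoothOnBand f) :
    ContinuousOn (bandLift f) {q | q.2 + 1 / 2 ∈ s} := by
  intro q hq
  have hp : planePoint q ∈ paperStrip s := planePoint_mem.2 hq
  obtain ⟨U, hU, hpU, g, hg, hgf⟩ := hf _ hp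
  have hc : ContinuousAt (g ∘ planePoint) q :=
    (hg.continuousOn.continuousAt (hU.mem_nhds hpU)).comp
      contDiff_planePoint.continuous.continuousAt
  refine hc.continuousWithinAt.congr_of_eventuallyEq ?_ ?_
  · filter_upwards [self_mem_nhdsWithin, nhdsWithin_le_nhds
      (contDiff_planePoint.continuous.continuousAt (hU.mem_nhds hpU))] with r hr hrU
    rw [bandLift_of_mem f (planePoint_mem.2 hr)]
    exact (hgf _ (planePoint_mem.2 hr) hrU).symm
  · rw [bandLift_of_mem f hp]
    exact (hgf _ hp hpU).symm

variable {w : ℝ} (hw : ∀ y : ℝ, |y| < w → y + 1 / 2 ∈ s)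
include hw

theorem IsSmoothOnBand.contDiffOn_bandLift (hf : IsSmoothOnBand f) :
    ContDiffOn ℝ ∞ (bandLift f) (openStrip w) := by
  intro q hq
  have hp : planePoint q ∈ paperStrip s := planePoint_mem.2 (hw _ hq)
  obtain ⟨U, hU, hpU, g, hg, hgf⟩ := hf _ hp
  have hc : ContDiffAt ℝ ∞ (g ∘ planePoint) q :=
    (hg.contDiffAt (hU.mem_nhds hpU)).comp q contDiff_planePoint.contDiffAt
  refine (hc.congr_of_eventuallyEq ?_).contDiffWithinAt
  filter_upwards [(isOpen_openStrip w).mem_nhds hq,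
    contDiff_planePoint.continuous.continuousAt (hU.mem_nhds hpU)] with r hr hrU
  have hr' : planePoint r ∈ paperStrip s := planePoint_mem.2 (hw _ hr)
  rw [bandLift_of_mem f hr']
  exact (hgf _ hr' hrU).symm

open Classical in
theorem PreservesArcLength.eVariationOn_bandLift_line (hf : PreservesArcLength f) {q v : ℝ × ℝ}
    {a b : ℝ} (hab : a ≤ b) (hseg : ∀ t ∈ Set.Icc a b, q + t • v ∈ openStrip w) :
    eVariationOn (fun t : ℝ => bandLift f (q + t • v)) (Set.Icc a b) =
      ‖planeVector v‖₊ * ENNReal.ofReal (b - a) := by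
  have hmem : ∀ t ∈ Set.Icc a b, planePoint (q + t • v) ∈ paperStrip s := fun t ht =>
    planePoint_mem.2 (hw _ (hseg t ht))
  -- The curve must be defined for all times; where the line has left the strip, it takes the value
  -- at `a`.
  set c : ℝ → paperStrip s := fun t =>
    if h : planePoint (q + t • v) ∈ paperStrip s then ⟨_, h⟩
    else ⟨_, hmem a (Set.left_mem_Icc.2 hab)⟩ with hc
  have hcval : ∀ t ∈ Set.Icc a b, (c t : PaperPlane) = planePoint q + t • planeVector v := by
    intro t ht
    simp only [hc, dif_pos (hmem t ht)]
    rw [planePoint_add, planeVector_smul]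
  have hcont : ContinuousOn c (Set.Icc a b) := by
    rw [Topology.IsInducing.subtypeVal.continuousOn_iff]
    refine ContinuousOn.congr (f := fun t : ℝ => planePoint q + t • planeVector v) (by fun_prop)
      fun t ht => hcval t ht
  have h1 := hf a b c hab hcont
  have h2 : eVariationOn c (Set.Icc a b) =
      eVariationOn (fun t => (c t : PaperPlane)) (Set.Icc a b) := rfl
  rw [h2, eVariationOn.eq_of_eqOn hcval, eVariationOn_line _ _ hab] at h1
  rw [← h1]
  refine eVariationOn.eq_of_eqOn fun t ht => ?_
  simp only [hc, dif_pos (hmem t ht)]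
  exact bandLift_of_mem f (hmem t ht)

/-- Arc length is needed only on straight segments: the image length, proportional to time, fixes
the speed. -/
theorem norm_dirDeriv_bandLift (hs : IsSmoothOnBand f) (hf : PreservesArcLength f) {q : ℝ × ℝ}
    (hq : q ∈ openStrip w) (v : ℝ × ℝ) : ‖dirDeriv v (bandLift f) q‖ = ‖planeVector v‖ := by
  have hsm := hs.contDiffOn_bandLift hw
  have hline : Continuous fun t : ℝ => q + t • v := by fun_prop
  have hq0 : q + (0 : ℝ) • v ∈ openStrip w := by simpa using hq
  obtain ⟨δ, hδ, hball⟩ := Metric.eventually_nhds_iff_ball.1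
    (hline.continuousAt.eventually ((isOpen_openStrip w).mem_nhds hq0))
  have hmem : ∀ t ∈ Set.Ioo (-δ) δ, q + t • v ∈ openStrip w := fun t ht =>
    hball t (by simpa [Real.ball_eq_Ioo] using ht)
  have key := norm_deriv_eq_of_eVariationOn (γ := fun t : ℝ => bandLift f (q + t • v))
    (γ' := fun t : ℝ => dirDeriv v (bandLift f) (q + t • v)) hδ (N := ‖planeVector v‖₊)
    (fun t ht => hasDerivAt_line (isOpen_openStrip w) hsm (hmem t ht)) ?_ ?_
  · simpa using key
  · refine ContinuousAt.comp (f := fun t : ℝ => q + t • v) (g := dirDeriv v (bandLift f)) ?_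
      hline.continuousAt
    exact (hsm.dirDeriv (isOpen_openStrip w) v).continuousOn.continuousAt
      ((isOpen_openStrip w).mem_nhds hq0)
  · intro a b ha hab hb
    exact hf.eVariationOn_bandLift_line hw hab fun t ht =>
      hmem t ⟨ha.trans_le ht.1, ht.2.trans_lt hb⟩

theorem IsSmoothIsometricEmbedding.isFlatMoebiusMap (hl : 0 < l) (hw0 : 0 < w)
    (hs : ∀ y : ℝ, -y + 1 / 2 ∈ s ↔ y + 1 / 2 ∈ s) (hf : IsSmoothIsometricEmbedding f) :
    IsFlatMoebiusMap l w (bandLift f) := by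
  have hnorm : ∀ q ∈ openStrip w, ∀ v, ‖dirDeriv v (bandLift f) q‖ = ‖planeVector v‖ :=
    fun q hq v => norm_dirDeriv_bandLift hw hf.smooth hf.isometric hq v
  have himm : ∀ q ∈ openStrip w, ∀ v, dirDeriv v (bandLift f) q = 0 → v = 0 := by
    intro q hq v hv
    refine planeVector_eq_zero (norm_eq_zero.1 ?_)
    rw [← hnorm q hq, hv, norm_zero]
  refine ⟨hl, hw0, ⟨isOpen_openStrip w, hf.smooth.contDiffOn_bandLift hw,
    ⟨fun v u => inner ℝ (planeVector v) (planeVector u), ?_⟩, ?_, by simp⟩,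
    fun q hq v hv h0 => hv (himm q hq v h0), bandLift_glide f hs⟩
  · intro q hq v u
    simp only
    -- Polarization: the norms of derivatives determine the metric.
    rw [real_inner_eq_norm_add_mul_self_sub_norm_mul_self_sub_norm_mul_self_div_two,
      real_inner_eq_norm_add_mul_self_sub_norm_mul_self_sub_norm_mul_self_div_two,
      ← dirDeriv_add_left, hnorm q hq, hnorm q hq, hnorm q hq, planeVector_add]
  · intro q hq
    refine ⟨(1, 0), (0, 1), LinearIndependent.pair_iff.2 fun a b hab => ?_⟩
    rw [← dirDeriv_smul_left, ← dirDeriv_smul_left, ← dirDeriv_add_left] at hab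
    have := himm q hq _ hab
    simpa using this

end Lift

theorem lemmaT (l : ℝ) (hl : 0 < l) (I : MoebiusBand l → PaperSpace)
    (hI : IsSmoothIsometricEmbedding I) :
    (∃ T B : Set PaperSpace, IsTPattern I T B ∧ T ∩ B ⊆ I '' MoebiusBand.boundary l) ∧
    (ExtendsIsometrically I → ∃ T B : Set PaperSpace, IsTPattern I T B ∧ Disjoint T B) := by
  have hIcc : ∀ y : ℝ, y + 1 / 2 ∈ Set.Icc (0 : ℝ) 1 ↔ |y| ≤ 1 / 2 := by
    intro y
    rw [Set.mem_Icc, abs_le]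
    constructor <;> rintro ⟨h1, h2⟩ <;> constructor <;> linarith
  have habs : ∀ p ∈ paperStrip (Set.Icc (0 : ℝ) 1), |p 1 - 1 / 2| ≤ 1 / 2 := by
    intro p hp
    rw [← hIcc, sub_add_cancel]
    exact hp
  constructor
  -- With `w = 1/2`, a common point has height at least and at most `1/2`, so it is on the boundary.
  · have hflat := hI.isFlatMoebiusMap (w := 1 / 2) (fun y hy => (hIcc y).2 hy.le) hl (by norm_num)
      (fun y => by rw [hIcc, hIcc, abs_neg])
    obtain ⟨T, B, hTB, hmeet⟩ := exists_isTPattern hflat le_rfl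
      (hI.smooth.continuousOn_bandLift.mono fun q hq => (hIcc _).2 hq)
      (fun p hp => by
        rw [bandLift_of_mem I (by rwa [planePoint_eq])]
        simp only [planePoint_eq]) hI.injective
    refine ⟨T, B, hTB, fun z hz => ?_⟩
    obtain ⟨p, hp, rfl⟩ := hmeet z hz
    refine ⟨_, ⟨p, ?_, rfl⟩, rfl⟩
    have h1 := le_antisymm (habs _ p.2) hp
    rcases (abs_eq (by norm_num)).1 h1 with h2 | h2
    · right
      linarith
    · left
      linarith
  · rintro ⟨ε, hε, J, hJ, hJI⟩
    have hIoo : ∀ y : ℝ, y + 1 / 2 ∈ Set.Ioo (-ε) (1 + ε) ↔ |y| < 1 / 2 + ε := by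
      intro y
      rw [Set.mem_Ioo, abs_lt]
      constructor <;> rintro ⟨h1, h2⟩ <;> constructor <;> linarith
    -- With `w = 1/2 + ε`, a common point would have a height that no point of the band `M_l` has.
    have hflat := hJ.isFlatMoebiusMap (w := 1 / 2 + ε) (fun y hy => (hIoo y).2 hy) hl
      (by linarith) (fun y => by rw [hIoo, hIoo, abs_neg])
    obtain ⟨T, B, hTB, hmeet⟩ := exists_isTPattern (I := I) hflat (by linarith)
      (hJ.smooth.continuousOn_bandLift.mono fun q hq =>
        (hIoo _).2 (lt_of_le_of_lt hq (by linarith)))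
      (fun p hp => by
        have hp' : p ∈ paperStrip (Set.Ioo (-ε) (1 + ε)) :=
          ⟨by linarith [hp.1], by linarith [hp.2]⟩
        rw [bandLift_of_mem J (by rwa [planePoint_eq]), ← hJI p hp hp']
        simp only [planePoint_eq]) hI.injective
    refine ⟨T, B, hTB, Set.disjoint_left.2 fun z hzT hzB => ?_⟩
    obtain ⟨p, hp, -⟩ := hmeet z ⟨hzT, hzB⟩
    linarith [habs _ p.2]
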